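/- Let $\mathcal F$ be a differential field of characteristic zero, i.e. a field of characteristic zero with a derivation $\partial$ (write $a'=\partial a$), and let $\mathcal C=\{c\in\mathcal F : c'=0\}$ be its subfield of constants. Let $\mathcal F[\partial]$ be the algebra of differential operators $\sum_n a_n\partial^n$ (finite sums, $a_n\in\mathcal F$), with product $\circ$ determined by $\partial\circ a=a\partial+a'$. An $\ell\times\ell$ matrix differential operator is an element $P(\partial)=\sum_n A_n\partial^n$ of $\mathrm{Mat}_{\ell\times\ell}(\mathcal F[\partial])$, $A_n\in\mathrm{Mat}_{\ell\times\ell}(\mathcal F)$; its adjoint is $P^*(\partial)=\sum_n(-\partial)^n\circ A_n^T$, and $P$ is called selfadjoint if $P^*=P$ and skewadjoint if $P^*=-P$. The field $\mathcal F$ is called linearly closed if every equation $a_nu^{(n)}+\dots+a_1u'+a_0u=b$ with $n\ge 0$, $a_0,\dots,a_n,b\in\mathcal F$, $a_n\neq0$, has a solution $u\in\mathcal F$, and has a nonzero solution if $b=0$ and $n\ge1$. Let $K(\partial)=\sum_{n=0}^N K_n\partial^n$ be an $\ell\times\ell$ matrix differential operator over $\mathcal F$ of order $N\ge 0$ with invertible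 leading coefficient $K_N$. (a) If $\mathcal F$ is linearly closed, then for every skewadjoint $\ell\times\ell$ matrix differential operator $S(\partial)$ there exists an $\ell\times\ell$ matrix differential operator $P(\partial)$ such that $$K(\partial)\circ P(\partial)-P^*(\partial)\circ K^*(\partial)=S(\partial).$$ (b) The set of $\ell\times\ell$ matrix differential operators $P(\partial)$ of order at most $N-1$ (only $P=0$ if $N=0$) such that $K(\partial)\circ P(\partial)$ is selfadjoint is a vector space over $\mathcal C$ of dimension at most $\binom{N\ell}{2}$, and of dimension equal to $\binom{N\ell}{2}$ if $\mathcal F$ is linearly closed. -/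

import Mathlib

open scoped Differential

noncomputable section

/-- The algebra `F[∂]` of scalar differential operators over a differential ring `F`.
The operator `∑ aₙ ∂ⁿ` is stored as its sequence of left coefficients, that is, as the polynomial
`∑ aₙ Xⁿ`; the product is the composition of operators, defined below, and not the
product of polynomials. -/
def DiffOp (F : Type*) [CommRing F] : Type _ := Polynomial F

namespace DiffOp

section

variable {F : Type*} [CommRing F]

instance : AddCommGroup (DiffOp F) := inferInstanceAs (AddCommGroup (Polynomial F))

/-- Multiplication of all left coefficients by an element of `F`: `c • ∑ aₙ ∂ⁿ = ∑ c aₙ ∂ⁿ`. -/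
instance : Module F (DiffOp F) := inferInstanceAs (Module F (Polynomial F))

/-- The coefficient `aₙ` in `P = ∑ aₙ ∂ⁿ`. -/
def coeff (P : DiffOp F) (n : ℕ) : F := Polynomial.coeff P n

/-- The operator `a ∂ⁿ`. -/
def monomial (n : ℕ) (a : F) : DiffOp F := Polynomial.monomial n a

theorem induction_on {p : DiffOp F → Prop} (P : DiffOp F)
    (hadd : ∀ P Q, p P → p Q → p (P + Q)) (hmon : ∀ n a, p (monomial n a)) : p P :=
  Polynomial.induction_on' (motive := p) P hadd hmon

theorem smul_monomial (n : ℕ) (a b : F) :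
    a • (monomial n b : DiffOp F) = monomial n (a * b) :=
  Polynomial.smul_monomial a n b

theorem monomial_zero (n : ℕ) : (monomial n 0 : DiffOp F) = 0 :=
  Polynomial.monomial_zero_right n

variable [Differential F]

/-- Composition with `∂` on the left: `∂ ∘ (∑ bₙ ∂ⁿ) = ∑ (bₙ ∂ⁿ⁺¹ + bₙ′ ∂ⁿ)`. -/
def dLeft : AddMonoid.End (DiffOp F) where
  toFun (Q : Polynomial F) := (Polynomial.X * Q + Differential.mapCoeffs Q : Polynomial F)
  map_zero' := by
    change ((Polynomial.X : Polynomial F) * (0 : Polynomial F) + Differential.mapCoeffs (0 : Polynomial F) :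
      Polynomial F) = (0 : Polynomial F)
    simp only [mul_zero, map_zero, add_zero]
  map_add' (P Q : Polynomial F) := by
    change (Polynomial.X * (P + Q) + Differential.mapCoeffs (P + Q) : Polynomial F) =
      (Polynomial.X * P + Differential.mapCoeffs P) + (Polynomial.X * Q + Differential.mapCoeffs Q)
    rw [mul_add, map_add]
    abel

/-- Composition with `P = ∑ aₙ ∂ⁿ` on the left: `Q ↦ ∑ aₙ (∂ ∘ ⋯ ∘ ∂ ∘ Q)`, with `n` factors `∂`
in the `n`-th term. -/
def opLeft : DiffOp F →+ DiffOp F →+ DiffOp F where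
  toFun P := Polynomial.sum (R := F) P fun n a => (DistribSMul.toAddMonoidHom (DiffOp F) a).comp (dLeft ^ n)
  map_zero' := Polynomial.sum_zero_index _
  map_add' P Q := by
    refine Polynomial.sum_add_index P Q _ (fun n => ?_) (fun n a b => ?_)
    · ext Q
      exact zero_smul F _
    · ext Q
      exact add_smul a b _

/-- The product of differential operators is their composition. -/
instance : Mul (DiffOp F) := ⟨fun P Q => opLeft P Q⟩

instance : One (DiffOp F) := ⟨monomial 0 1⟩

theorem opLeft_monomial (n : ℕ) (a : F) (Q : DiffOp F) :
    opLeft (monomial n a) Q = a • (dLeft ^ n) Q := by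
  have h : opLeft (monomial n a) = (DistribSMul.toAddMonoidHom (DiffOp F) a).comp (dLeft ^ n) := by
    refine Polynomial.sum_monomial_index (R := F) (S := DiffOp F →+ DiffOp F) (n := n) a
      (fun n a => (DistribSMul.toAddMonoidHom (DiffOp F) a).comp (dLeft ^ n)) ?_
    ext Q
    exact zero_smul F _
  rw [h]
  rfl

theorem dLeft_smul (a : F) (Q : DiffOp F) : dLeft (a • Q) = a • dLeft Q + (a′) • Q := by
  let q : Polynomial F := Q
  change (Polynomial.X * (a • q) + Differential.mapCoeffs (a • q) :
    Polynomial F) = a • (Polynomial.X * q +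
      Differential.mapCoeffs q) + (a′) • q
  ext n
  simp [Polynomial.smul_eq_C_mul, Polynomial.coeff_C_mul, Differential.coeff_mapCoeffs,
    mul_left_comm (Polynomial.X : Polynomial F)]
  ring

theorem dLeft_monomial (n : ℕ) (a : F) :
    dLeft (monomial n a) = monomial (n + 1) a + monomial n (a′) := by
  change (Polynomial.X * Polynomial.monomial n a + Differential.mapCoeffs (Polynomial.monomial n a) :
    Polynomial F) = Polynomial.monomial (n + 1) a + Polynomial.monomial n (a′)
  rw [Polynomial.X_mul_monomial, Differential.mapCoeffs_monomial]

theorem opLeft_smul (a : F) (P Q : DiffOp F) : opLeft (a • P) Q = a • opLeft P Q := by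
  induction P using induction_on with
  | hadd P R hP hR =>
    rw [smul_add, map_add, map_add, AddMonoidHom.add_apply, AddMonoidHom.add_apply, hP, hR,
      smul_add]
  | hmon n b =>
    have h : a • (monomial n b : DiffOp F) = monomial n (a * b) := Polynomial.smul_monomial a n b
    rw [h, opLeft_monomial, opLeft_monomial, mul_smul]

theorem opLeft_dLeft (P Q : DiffOp F) : opLeft (dLeft P) Q = dLeft (opLeft P Q) := by
  induction P using induction_on with
  | hadd P R hP hR =>
    rw [map_add, map_add, map_add, AddMonoidHom.add_apply, AddMonoidHom.add_apply, hP, hR, map_add]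
  | hmon n b =>
    rw [dLeft_monomial, map_add, AddMonoidHom.add_apply, opLeft_monomial, opLeft_monomial,
      opLeft_monomial, dLeft_smul, pow_succ']
    rfl

theorem opLeft_mul (P Q R : DiffOp F) : opLeft (opLeft P Q) R = opLeft P (opLeft Q R) := by
  induction P using induction_on with
  | hadd P P' hP hP' =>
    rw [map_add, AddMonoidHom.add_apply, map_add, AddMonoidHom.add_apply, hP, hP',
      AddMonoidHom.add_apply]
  | hmon n a =>
    rw [opLeft_monomial, opLeft_monomial, opLeft_smul]
    congr 1
    induction n with
    | zero => rfl
    | succ n ih =>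
      rw [pow_succ', AddMonoid.End.coe_mul, Function.comp_apply, Function.comp_apply,
        opLeft_dLeft, ih]

theorem dLeft_pow_one (n : ℕ) : (dLeft ^ n) (monomial 0 1 : DiffOp F) = monomial n 1 := by
  induction n with
  | zero => rw [pow_zero, AddMonoid.End.coe_one, id_eq]
  | succ n ih =>
    rw [pow_succ', AddMonoid.End.coe_mul, Function.comp_apply]
    have h0 : ((1 : F)′) = 0 := Derivation.map_one_eq_zero _
    rw [ih, dLeft_monomial, h0, monomial_zero, add_zero]

theorem opLeft_one (P : DiffOp F) : opLeft P (monomial 0 1) = P := by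
  induction P using induction_on with
  | hadd P Q hP hQ => rw [map_add, AddMonoidHom.add_apply, hP, hQ]
  | hmon n a => rw [opLeft_monomial, dLeft_pow_one, smul_monomial, mul_one]

instance : Ring (DiffOp F) :=
  { (inferInstance : AddCommGroup (DiffOp F)),
    (inferInstance : Mul (DiffOp F)),
    (inferInstance : One (DiffOp F)) with
    mul_assoc := opLeft_mul
    one_mul := fun P => (opLeft_monomial 0 1 P).trans (one_smul F P)
    mul_one := opLeft_one
    zero_mul := fun P => by
      change opLeft 0 P = 0
      rw [map_zero, AddMonoidHom.zero_apply]
    mul_zero := fun P => map_zero (opLeft P)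
    left_distrib := fun P Q R => map_add (opLeft P) Q R
    right_distrib := fun P Q R => by
      change opLeft (P + Q) R = opLeft P R + opLeft Q R
      rw [map_add, AddMonoidHom.add_apply] }

/-- The operator `∂`. -/
def del : DiffOp F := monomial 1 1

/-- The operator of multiplication by `a`. -/
def mulOp (a : F) : DiffOp F := monomial 0 a

/-- The commutation rule `∂ ∘ a = a ∂ + a′`. -/
theorem del_mul_mulOp (a : F) : (del : DiffOp F) * mulOp a = mulOp a * del + mulOp (a′) := by
  change opLeft (monomial 1 1) (monomial 0 a) =
    opLeft (monomial 0 a) (monomial 1 1) + monomial 0 (a′)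
  rw [opLeft_monomial, opLeft_monomial, one_smul, pow_one, dLeft_monomial]
  congr 1
  rw [pow_zero, AddMonoid.End.coe_one, id_eq, smul_monomial, mul_one]

/-- The formal adjoint `(∑ aₙ ∂ⁿ)^* = ∑ (-∂)ⁿ ∘ aₙ`. -/
def adjoint (P : DiffOp F) : DiffOp F :=
  Polynomial.sum (R := F) P fun n a => (-del) ^ n * mulOp a

end

end DiffOp

/-- `ℓ × ℓ` matrix differential operators over `F`. -/
abbrev MatDiffOp (ℓ : ℕ) (F : Type*) [CommRing F] : Type _ := Matrix (Fin ℓ) (Fin ℓ) (DiffOp F)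

namespace MatDiffOp

section

variable {ℓ : ℕ} {F : Type*} [CommRing F]

/-- The coefficient `Aₙ`, an `ℓ × ℓ` matrix over `F`, in `P = ∑ Aₙ ∂ⁿ`. -/
def coeff (P : MatDiffOp ℓ F) (n : ℕ) : Matrix (Fin ℓ) (Fin ℓ) F :=
  Matrix.of fun i j => (P i j).coeff n

/-- `P = ∑ Aₙ ∂ⁿ` has order strictly less than `N`: all `Aₙ` with `n ≥ N` vanish. For `N = 0`
only the zero operator qualifies. -/
def OrderLT (P : MatDiffOp ℓ F) (N : ℕ) : Prop := ∀ n, N ≤ n → coeff P n = 0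

variable [Differential F]

/-- The formal adjoint: `(∑ Aₙ ∂ⁿ)^* = ∑ (-∂)ⁿ ∘ Aₙᵀ`, i.e. `(P^*)ᵢⱼ = (Pⱼᵢ)^*`. -/
def adjoint (P : MatDiffOp ℓ F) : MatDiffOp ℓ F :=
  Matrix.of fun i j => (P j i).adjoint

/-- `P^* = P`. -/
def IsSelfadjoint (P : MatDiffOp ℓ F) : Prop := adjoint P = P

/-- `P^* = -P`. -/
def IsSkewadjoint (P : MatDiffOp ℓ F) : Prop := adjoint P = -P

end

end MatDiffOp

/-- The subfield of constants of a differential field. -/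
def constantSubfield (F : Type*) [Field F] [Differential F] : Subfield F where
  carrier := {c | c′ = 0}
  mul_mem' {a b} ha hb := by
    have ha' : a′ = 0 := ha
    have hb' : b′ = 0 := hb
    simp [ha', hb']
  one_mem' := by simp
  add_mem' {a b} ha hb := by
    have ha' : a′ = 0 := ha
    have hb' : b′ = 0 := hb
    simp [ha', hb']
  zero_mem' := by simp
  neg_mem' {a} ha := by
    have ha' : a′ = 0 := ha
    simp [ha']
  inv_mem' a ha := by
    have ha' : a′ = 0 := ha
    simp [Derivation.leibniz_inv, ha']

/-- A differential field is linearly closed if every linear differential equation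
`aₙ u⁽ⁿ⁾ + ⋯ + a₁ u′ + a₀ u = b` with `aₙ ≠ 0` has a solution, and a nonzero one if `b = 0` and
`n ≥ 1`. -/
def LinearlyClosed (F : Type*) [Field F] [Differential F] : Prop :=
  ∀ (n : ℕ) (a : ℕ → F), a n ≠ 0 →
    (∀ b : F, ∃ u : F, ∑ i ∈ Finset.range (n + 1), a i * (fun x : F => x′)^[i] u = b) ∧
    (1 ≤ n → ∃ u : F, u ≠ 0 ∧ ∑ i ∈ Finset.range (n + 1), a i * (fun x : F => x′)^[i] u = 0)

end

/-! For N = M+1, let A be the block companion matrix of K, let eₖ be the inclusion of block k, let H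
be the row of truncated operators Hₖ = ∑ₙ Kₖ₊₁₊ₙ ∂ⁿ (k ≤ M), and let Y = H^*. The passage to a
first-order system is the identity H(∂ - A) = K e₀ᵀ, whose adjoint is (∂ + Aᵀ)Y = -e₀ K^*. For a
block matrix X over F put P_X = e₀ᵀ X Y (`ofBlocks`). Moving ∂ across X gives the identity behind
both parts (`mul_ofBlocks`): K P_X = H (∇X) Y - (P_{Xᵀ})^* K^*, where ∇X = X′ - AX - XAᵀ.

For (b): every operator of order at most M is xY for a unique matrix x over F, because the
coefficients of Y form an invertible block triangular matrix. If X is antisymmetric and ∇X = 0, the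
identity says that K P_X is selfadjoint. Conversely, a first block row x extends to X with ∇X
supported in the last block row; selfadjointness and a comparison of orders then force ∇X = 0 and Xᵀ
= -X. The space in question is thus the space of horizontal vectors of a connection on antisymmetric
Nℓ × Nℓ matrices, a space of dimension binom(Nℓ, 2) over F. Horizontal vectors independent over the
constants are independent over F, which gives the bound; over a linearly closed field they also
span, which gives equality.

For (a): halving S reduces the claim to solving K P + Q K^* = R. Right division by K^* leaves a
remainder sY. Since H e_M = K_N, it suffices to solve ∇X = e_M K_N⁻¹ s, and ∇ is surjective over a
linearly closed field. -/

noncomputable section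

/-! ### Connections over a differential field and their horizontal vectors -/

section Connection

variable {F M : Type*} [Field F] [AddCommGroup M] [Module F M]

/-- The infinitely many iterates of `v` are dependent in a finite-dimensional space, and `m` is the
largest index with a nonzero coefficient. The relation is stated modulo `E` so that its length can
later be minimised modulo `E`. -/
theorem exists_combination_iterate_mem [FiniteDimensional F M] (D : M →+ M) (E : Submodule F M)
    (v : M) : ∃ (m : ℕ) (a : ℕ → F), a m ≠ 0 ∧
      ∑ k ∈ Finset.range (m + 1), a k • D^[k] v ∈ E := by
  classical
  have hli : ¬ LinearIndependent F fun k : ℕ => D^[k] v := fun h =>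
    not_finite_iff_infinite.mpr (inferInstance : Infinite ℕ) h.finite
  obtain ⟨s, g, hg, i, hi, hgi⟩ := not_linearIndependent_iff.mp hli
  let t := s.filter fun k => g k ≠ 0
  have hit : i ∈ t := Finset.mem_filter.mpr ⟨hi, hgi⟩
  let m := t.max' ⟨i, hit⟩
  have hm : m ∈ t := t.max'_mem _
  refine ⟨m, fun k => if k ∈ s then g k else 0, ?_, ?_⟩
  · have := Finset.mem_filter.mp hm
    simpa [this.1] using this.2
  · have hsum : ∑ k ∈ Finset.range (m + 1), (if k ∈ s then g k else 0) • D^[k] v = 0 := by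
      rw [← hg]
      have h1 : ∑ k ∈ s, g k • D^[k] v = ∑ k ∈ t, g k • D^[k] v := by
        refine (Finset.sum_subset (Finset.filter_subset _ _) fun k hk hkt => ?_).symm
        have : g k = 0 := by
          by_contra h
          exact hkt (Finset.mem_filter.mpr ⟨hk, h⟩)
        rw [this, zero_smul]
      rw [h1]
      symm
      have hsub : t ⊆ Finset.range (m + 1) := fun k hk =>
        Finset.mem_range.mpr (Nat.lt_succ_of_le (t.le_max' k hk))
      rw [← Finset.sum_subset hsub]
      · refine Finset.sum_congr rfl fun k hk => ?_
        rw [if_pos (Finset.mem_filter.mp hk).1]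
      · intro k _ hkt
        by_cases hks : k ∈ s
        · have : g k = 0 := by
            by_contra h
            exact hkt (Finset.mem_filter.mpr ⟨hks, h⟩)
          rw [if_pos hks, this, zero_smul]
        · rw [if_neg hks, zero_smul]
    rw [hsum]
    exact E.zero_mem

variable [Differential F]

/-- An additive endomorphism of an `F`-vector space satisfying the Leibniz rule. -/
def IsConnection (F : Type*) {M : Type*} [Field F] [Differential F] [AddCommGroup M] [Module F M]
    (D : M →+ M) : Prop :=
  ∀ (a : F) (v : M), D (a • v) = a′ • v + a • D v

/-- The space over the constants of the horizontal vectors of a connection. -/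
def horizontal {D : M →+ M} (hD : IsConnection F D) : Submodule (constantSubfield F) M where
  carrier := {v | D v = 0}
  add_mem' {v w} hv hw := by
    have hv' : D v = 0 := hv
    have hw' : D w = 0 := hw
    simp [hv', hw']
  zero_mem' := by simp
  smul_mem' c v hv := by
    have hv' : D v = 0 := hv
    have hc : (c : F)′ = 0 := c.2
    change D ((c : F) • v) = 0
    rw [hD, hv', hc, zero_smul, smul_zero, add_zero]

theorem mem_horizontal {D : M →+ M} (hD : IsConnection F D) {v : M} :
    v ∈ horizontal hD ↔ D v = 0 := Iff.rfl

theorem IsConnection.map_sum_smul {D : M →+ M} (hD : IsConnection F D) {κ : Type*}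
    (s : Finset κ) (g : κ → F) (v : κ → M) :
    D (∑ i ∈ s, g i • v i) = ∑ i ∈ s, ((g i)′ • v i + g i • D (v i)) := by
  rw [map_sum]
  exact Finset.sum_congr rfl fun i _ => hD _ _

/-- Horizontal vectors that are independent over the constants are independent over `F`. -/
theorem IsConnection.linearIndependent {D : M →+ M} (hD : IsConnection F D) {κ : Type*}
    {v : κ → M} (hv : ∀ i, D (v i) = 0) (hli : LinearIndependent (constantSubfield F) v) :
    LinearIndependent F v := by
  classical
  rw [linearIndependent_iff']
  intro s
  induction s using Finset.induction_on with
  | empty => intro g _ i hi; simp at hi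
  | insert j s hj ih =>
    intro g hg
    have hgj : g j = 0 := by
      by_contra hne
      -- With the coefficient of `v j` normalised to 1, applying `D` removes that term. The
      -- induction hypothesis then makes all coefficients constant, contradicting independence over
      -- the constants.
      set h : κ → F := fun i => (g j)⁻¹ * g i with hh
      have hhj : h j = 1 := inv_mul_cancel₀ hne
      have hsum : ∑ i ∈ insert j s, h i • v i = 0 := by
        simp only [hh, mul_smul]
        rw [← Finset.smul_sum, hg, smul_zero]
      have hD0 := congrArg D hsum
      rw [hD.map_sum_smul, map_zero, Finset.sum_insert hj, hhj] at hD0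
      simp only [hv, smul_zero, add_zero, Derivation.map_one_eq_zero, zero_smul, zero_add] at hD0
      have hconst := ih _ hD0
      have hmem : ∀ i ∈ insert j s, h i ∈ constantSubfield F := by
        intro i hi
        change (h i)′ = 0
        rcases Finset.mem_insert.mp hi with rfl | hi
        · rw [hhj, Derivation.map_one_eq_zero]
        · exact hconst i hi
      let c : κ → constantSubfield F := fun i => if hi : i ∈ insert j s then ⟨h i, hmem i hi⟩ else 0
      have hc : ∑ i ∈ insert j s, c i • v i = 0 := by
        rw [← hsum]
        refine Finset.sum_congr rfl fun i hi => ?_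
        simp only [c, dif_pos hi]
        rfl
      have h0 := linearIndependent_iff'.mp hli _ c hc j (Finset.mem_insert_self j s)
      simp only [c, dif_pos (Finset.mem_insert_self j s)] at h0
      have h1 := congrArg Subtype.val h0
      exact one_ne_zero (hhj.symm.trans h1)
    rw [Finset.sum_insert hj, hgj, zero_smul, zero_add] at hg
    intro i hi
    rcases Finset.mem_insert.mp hi with rfl | hi
    · exact hgj
    · exact ih g hg i hi

theorem rank_horizontal_le {D : M →+ M} (hD : IsConnection F D) :
    Module.rank (constantSubfield F) (horizontal hD) ≤ Module.rank F M := by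
  let b := Module.Free.chooseBasis (constantSubfield F) (horizontal hD)
  rw [← b.mk_eq_rank'']
  have hli : LinearIndependent (constantSubfield F) fun i => (b i : M) :=
    b.linearIndependent.map' (horizontal hD).subtype (Submodule.ker_subtype _)
  exact (hD.linearIndependent (fun i => (b i).2) hli).cardinal_le_rank

theorem LinearlyClosed.exists_deriv_eq (hF : LinearlyClosed F) (b : F) : ∃ u : F, u′ = b := by
  obtain ⟨u, hu⟩ := (hF 1 (fun i => if i = 1 then 1 else 0) (by simp)).1 b
  exact ⟨u, by simpa [Finset.sum_range_succ] using hu⟩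

/-- The operators `L₀ u = u`, `Lⱼ₊₁ u = bⱼ u - (Lⱼ u)′`. -/
def hornerOp (b : ℕ → F) : ℕ → F → F
  | 0, u => u
  | j + 1, u => b j * u - (hornerOp b j u)′

/-- Each step of the recursion differentiates once with a sign, so the top coefficient is ±1; its
nonvanishing is what linear closedness requires. -/
theorem hornerOp_eq_sum (b : ℕ → F) (j : ℕ) :
    ∃ a : ℕ → F, a j ≠ 0 ∧
      ∀ u, hornerOp b j u = ∑ i ∈ Finset.range (j + 1), a i * (fun x : F => x′)^[i] u := by
  induction j with
  | zero => exact ⟨fun _ => 1, one_ne_zero, fun u => by simp [hornerOp]⟩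
  | succ j ih =>
    obtain ⟨a, ha, h⟩ := ih
    refine ⟨fun i => (if i = 0 then b j else -a (i - 1)) - (if i ≤ j then (a i)′ else 0),
      by simpa using ha, fun u => ?_⟩
    have h1 : ∑ i ∈ Finset.range (j + 2), (if i = 0 then b j else -a (i - 1)) *
        (fun x : F => x′)^[i] u =
        b j * u - ∑ i ∈ Finset.range (j + 1), a i * (fun x : F => x′)^[i + 1] u := by
      rw [Finset.sum_range_succ']
      simp
      ring
    have h2 : ∑ i ∈ Finset.range (j + 2), (if i ≤ j then (a i)′ else 0) *
        (fun x : F => x′)^[i] u =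
        ∑ i ∈ Finset.range (j + 1), (a i)′ * (fun x : F => x′)^[i] u := by
      rw [Finset.sum_range_succ, if_neg (by lia), zero_mul, add_zero]
      refine Finset.sum_congr rfl fun i hi => ?_
      rw [if_pos (Nat.lt_succ_iff.mp (Finset.mem_range.mp hi))]
    simp only [sub_mul, Finset.sum_sub_distrib]
    rw [h1, h2, hornerOp, h, map_sum, sub_sub, ← Finset.sum_add_distrib]
    congr 1
    refine Finset.sum_congr rfl fun i _ => ?_
    rw [Derivation.leibniz, Function.iterate_succ_apply', smul_eq_mul, smul_eq_mul]
    ring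

/-- Over a linearly closed field, a nonzero finite-dimensional quotient by a stable subspace has a
nonzero horizontal vector. -/
theorem LinearlyClosed.exists_horizontal_mod (hF : LinearlyClosed F) [FiniteDimensional F M]
    {D : M →+ M} (hD : IsConnection F D) (E : Submodule F M) {v₀ : M} (hv₀ : v₀ ∉ E) :
    ∃ v, v ∉ E ∧ D v ∈ E := by
  classical
  have hex := exists_combination_iterate_mem D E v₀
  obtain ⟨a, ha, haE⟩ := Nat.find_spec hex
  -- By minimality of the relation, a shorter combination with nonzero top coefficient is
  -- automatically outside `E`; this will certify the vector found below.
  have hmin : ∀ k < Nat.find hex, ∀ c : ℕ → F, c k ≠ 0 →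
      ∑ i ∈ Finset.range (k + 1), c i • D^[i] v₀ ∉ E := fun k hk c hc h =>
    Nat.find_min hex hk ⟨c, hc, h⟩
  generalize Nat.find hex = m at a ha haE hmin
  obtain _ | m := m
  · refine absurd ?_ hv₀
    have := E.smul_mem (a 0)⁻¹ haE
    simpa [ha] using this
  let b : ℕ → F := fun k => (a (m + 1))⁻¹ * a k
  have hb : ∑ k ∈ Finset.range (m + 1), b k • D^[k] v₀ + D^[m + 1] v₀ ∈ E := by
    have := E.smul_mem (a (m + 1))⁻¹ haE
    rw [Finset.sum_range_succ, smul_add, smul_smul, inv_mul_cancel₀ ha, one_smul,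
      Finset.smul_sum] at this
    simpa [b, mul_smul] using this
  obtain ⟨r, hr, hrL⟩ := hornerOp_eq_sum (fun j => b (m - j)) (m + 1)
  obtain ⟨u, hu, hu0⟩ := (hF (m + 1) r hr).2 (by lia)
  rw [← hrL] at hu0
  -- The vector sought is w = ∑ eⱼ₊₁ Dʲ v₀ with Dw equal to `u` times the monic relation. Comparing
  -- coefficients gives eₘ₊₁ = u, eⱼ₊₁′ = bⱼ u - eⱼ and e₀ = 0: the downward recursion is
  -- `hornerOp`, and the last condition is the scalar equation solved by `u`.
  let e : ℕ → F := fun j => hornerOp (fun j => b (m - j)) (m + 1 - j) u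
  have he0 : e 0 = 0 := hu0
  have hem : e (m + 1) = u := by simp [e, hornerOp]
  have he : ∀ j < m + 1, (e (j + 1))′ = b j * u - e j := by
    intro j hj
    have h1 : m + 1 - j = (m - j) + 1 := by lia
    have h2 : m + 1 - (j + 1) = m - j := by lia
    have h3 : m - (m - j) = j := by lia
    simp only [e, h1, h2, hornerOp, h3]
    ring
  refine ⟨∑ j ∈ Finset.range (m + 1), e (j + 1) • D^[j] v₀,
    hmin m (by lia) (fun j => e (j + 1)) (by rw [hem]; exact hu), ?_⟩
  have key : D (∑ j ∈ Finset.range (m + 1), e (j + 1) • D^[j] v₀) =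
      u • (∑ k ∈ Finset.range (m + 1), b k • D^[k] v₀ + D^[m + 1] v₀) := by
    rw [hD.map_sum_smul]
    have htel := Finset.sum_range_sub (fun j => e j • D^[j] v₀) (m + 1)
    rw [he0, hem, zero_smul, sub_zero] at htel
    rw [smul_add, ← htel, Finset.smul_sum, ← Finset.sum_add_distrib]
    refine Finset.sum_congr rfl fun j hj => ?_
    rw [he j (Finset.mem_range.mp hj), ← Function.iterate_succ_apply' D, sub_smul, smul_smul,
      mul_comm u]
    abel
  rw [key]
  exact E.smul_mem _ hb

theorem LinearlyClosed.exists_mem_span_horizontal (hF : LinearlyClosed F) {D : M →+ M}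
    (hD : IsConnection F D) {w : M} (hw : w ∈ Submodule.span F (horizontal hD : Set M)) :
    ∃ t ∈ Submodule.span F (horizontal hD : Set M), D t = w := by
  -- All multiples of `w` are treated at once because `D` is not F-linear: in the scalar step the
  -- factor `c` must be absorbed into `a`.
  suffices h : ∀ a : F, ∃ t ∈ Submodule.span F (horizontal hD : Set M), D t = a • w by
    simpa using h 1
  induction hw using Submodule.span_induction with
  | mem x hx =>
    intro a
    obtain ⟨b, hb⟩ := hF.exists_deriv_eq a
    refine ⟨b • x, Submodule.smul_mem _ _ (Submodule.subset_span hx), ?_⟩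
    rw [hD, (mem_horizontal hD).mp hx, hb, smul_zero, add_zero]
  | zero => exact fun a => ⟨0, Submodule.zero_mem _, by simp⟩
  | add x y _ _ hx hy =>
    intro a
    obtain ⟨s, hs, hs'⟩ := hx a
    obtain ⟨t, ht, ht'⟩ := hy a
    exact ⟨s + t, Submodule.add_mem _ hs ht, by rw [map_add, hs', ht', smul_add]⟩
  | smul c x _ hx =>
    intro a
    obtain ⟨t, ht, ht'⟩ := hx (a * c)
    exact ⟨t, ht, by rw [ht', mul_smul]⟩

/-- Over a linearly closed field the horizontal vectors span. -/
theorem LinearlyClosed.span_horizontal (hF : LinearlyClosed F) [FiniteDimensional F M]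
    {D : M →+ M} (hD : IsConnection F D) : Submodule.span F (horizontal hD : Set M) = ⊤ := by
  by_contra hne
  obtain ⟨v₀, hv₀⟩ : ∃ v, v ∉ Submodule.span F (horizontal hD : Set M) := by
    by_contra! h
    exact hne (Submodule.eq_top_iff'.mpr h)
  obtain ⟨v, hv, hDv⟩ := hF.exists_horizontal_mod hD _ hv₀
  obtain ⟨t, ht, hDt⟩ := hF.exists_mem_span_horizontal hD hDv
  refine hv ?_
  -- `D` maps the span onto itself, so `v` can be corrected by an element of the span to become
  -- horizontal, which puts `v` in the span after all.
  have : v - t ∈ horizontal hD := by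
    rw [mem_horizontal, map_sub, hDt, sub_self]
  simpa using Submodule.add_mem _ (Submodule.subset_span this) ht

theorem LinearlyClosed.connection_surjective (hF : LinearlyClosed F) [FiniteDimensional F M]
    {D : M →+ M} (hD : IsConnection F D) : Function.Surjective D := fun w => by
  obtain ⟨t, -, ht⟩ := hF.exists_mem_span_horizontal hD
    (w := w) (by rw [hF.span_horizontal hD]; trivial)
  exact ⟨t, ht⟩

/-- A basis of the horizontal vectors over the constants is a basis of `M` over `F`: independence
holds for any connection, spanning by linear closedness. -/
theorem LinearlyClosed.rank_horizontal (hF : LinearlyClosed F) [FiniteDimensional F M]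
    {D : M →+ M} (hD : IsConnection F D) :
    Module.rank (constantSubfield F) (horizontal hD) = Module.rank F M := by
  let b := Module.Free.chooseBasis (constantSubfield F) (horizontal hD)
  have hli : LinearIndependent (constantSubfield F) fun i => (b i : M) :=
    b.linearIndependent.map' (horizontal hD).subtype (Submodule.ker_subtype _)
  have hliF := hD.linearIndependent (fun i => (b i).2) hli
  refine le_antisymm (rank_horizontal_le hD) ?_
  rw [← b.mk_eq_rank'', ← (Module.Basis.mk hliF ?_).mk_eq_rank'']
  rw [← hF.span_horizontal hD, Submodule.span_le]
  intro v hv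
  have h1 := b.mem_span ⟨v, hv⟩
  have h2 := Submodule.mem_map_of_mem (f := (horizontal hD).subtype) h1
  rw [Submodule.map_span, ← Set.range_comp] at h2
  exact Submodule.span_le_restrictScalars (constantSubfield F) F _ h2

end Connection
end

noncomputable section

/-! ### Leading coefficients and adjoints of scalar operators -/

namespace DiffOp

section Algebra

variable {F : Type*} [CommRing F]

theorem ext {P Q : DiffOp F} (h : ∀ n, P.coeff n = Q.coeff n) : P = Q := Polynomial.ext h

/-- The coefficient of `∂ⁿ` as a linear form. -/
def coeffLin (n : ℕ) : DiffOp F →ₗ[F] F := Polynomial.lcoeff F n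

theorem coeff_zero (n : ℕ) : (0 : DiffOp F).coeff n = 0 := map_zero (coeffLin n)

theorem coeff_add (P Q : DiffOp F) (n : ℕ) : (P + Q).coeff n = P.coeff n + Q.coeff n :=
  map_add (coeffLin n) P Q

theorem coeff_sub (P Q : DiffOp F) (n : ℕ) : (P - Q).coeff n = P.coeff n - Q.coeff n :=
  map_sub (coeffLin n) P Q

theorem coeff_neg (P : DiffOp F) (n : ℕ) : (-P).coeff n = -P.coeff n :=
  map_neg (coeffLin n) P

theorem coeff_smul (a : F) (P : DiffOp F) (n : ℕ) : (a • P).coeff n = a * P.coeff n :=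
  map_smul (coeffLin n) a P

theorem coeff_sum {κ : Type*} (s : Finset κ) (P : κ → DiffOp F) (n : ℕ) :
    (∑ i ∈ s, P i).coeff n = ∑ i ∈ s, (P i).coeff n := map_sum (coeffLin n) P s

theorem coeff_monomial (m n : ℕ) (a : F) :
    (monomial m a).coeff n = if m = n then a else 0 := Polynomial.coeff_monomial

theorem monomial_add (n : ℕ) (a b : F) :
    (monomial n (a + b) : DiffOp F) = monomial n a + monomial n b :=
  map_add (Polynomial.monomial n) a b

theorem exists_coeff_eq_zero (P : DiffOp F) : ∃ m, ∀ n, m ≤ n → P.coeff n = 0 :=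
  ⟨Polynomial.natDegree (R := F) P + 1, fun _ hn => Polynomial.coeff_eq_zero_of_natDegree_lt hn⟩

theorem mulOp_zero : mulOp (0 : F) = 0 := monomial_zero 0

theorem mulOp_one : mulOp (1 : F) = 1 := rfl

variable [Differential F]

theorem mul_eq_opLeft (P Q : DiffOp F) : P * Q = opLeft P Q := rfl

theorem mulOp_mul (a : F) (P : DiffOp F) : mulOp a * P = a • P := by
  rw [mul_eq_opLeft, mulOp, opLeft_monomial, pow_zero, AddMonoid.End.coe_one, id_eq]

theorem smul_mul (a : F) (P Q : DiffOp F) : (a • P) * Q = a • (P * Q) := opLeft_smul a P Q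

/-- The inclusion of `F` in `F[∂]`. -/
def mulOpHom : F →+* DiffOp F where
  toFun := mulOp
  map_one' := rfl
  map_mul' a b := by rw [mulOp_mul, mulOp, mulOp, smul_monomial]
  map_zero' := monomial_zero 0
  map_add' := monomial_add 0

theorem mulOpHom_apply (a : F) : mulOpHom a = mulOp a := rfl

theorem del_mul (P : DiffOp F) : del * P = dLeft P := by
  rw [mul_eq_opLeft, del, opLeft_monomial, one_smul, pow_one]

theorem del_pow (n : ℕ) : (del : DiffOp F) ^ n = monomial n 1 := by
  induction n with
  | zero => rfl
  | succ n ih =>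
    rw [pow_succ', ih, del_mul, dLeft_monomial, Derivation.map_one_eq_zero, monomial_zero, add_zero]

theorem mulOp_mul_del_pow (a : F) (n : ℕ) : mulOp a * del ^ n = monomial n a := by
  rw [mulOp_mul, del_pow, smul_monomial, mul_one]

theorem monomial_mul_del (n : ℕ) (a : F) : monomial n a * del = monomial (n + 1) a := by
  rw [← mulOp_mul_del_pow, mul_assoc, ← pow_succ, mulOp_mul_del_pow]

theorem coeff_mul_del_zero (P : DiffOp F) : (P * del).coeff 0 = 0 := by
  induction P using induction_on with
  | hadd P Q hP hQ => rw [add_mul, coeff_add, hP, hQ, add_zero]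
  | hmon n a => rw [monomial_mul_del, coeff_monomial, if_neg (Nat.succ_ne_zero n)]

theorem coeff_mul_del_succ (P : DiffOp F) (k : ℕ) : (P * del).coeff (k + 1) = P.coeff k := by
  induction P using induction_on with
  | hadd P Q hP hQ => rw [add_mul, coeff_add, coeff_add, hP, hQ]
  | hmon n a => simp only [monomial_mul_del, coeff_monomial, Nat.add_right_cancel_iff]

theorem coeff_del_mul_succ (P : DiffOp F) (k : ℕ) :
    (del * P).coeff (k + 1) = P.coeff k + (P.coeff (k + 1))′ := by
  let p : Polynomial F := P
  rw [del_mul]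
  change (Polynomial.X * p + Differential.mapCoeffs p : Polynomial F).coeff (k + 1) =
    p.coeff k + ((p.coeff (k + 1))′)
  rw [Polynomial.coeff_add, Polynomial.coeff_X_mul, Differential.coeff_mapCoeffs]

/-- The leading coefficient of `∂ⁱ ∘ Q`. -/
theorem coeff_del_pow_mul {Q : DiffOp F} {n : ℕ} (hQ : ∀ k, n < k → Q.coeff k = 0) (i : ℕ) :
    (del ^ i * Q).coeff (i + n) = Q.coeff n ∧ ∀ k, i + n < k → (del ^ i * Q).coeff k = 0 := by
  induction i with
  | zero => simpa using hQ
  | succ i ih =>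
    have h : ∀ k, i + n < k → (del ^ (i + 1) * Q).coeff k = (del ^ i * Q).coeff (k - 1) := by
      intro k hk
      obtain ⟨k, rfl⟩ : ∃ j, k = j + 1 := ⟨k - 1, by lia⟩
      rw [pow_succ', mul_assoc, coeff_del_mul_succ, ih.2 _ hk, Derivation.map_zero, add_zero,
        Nat.add_sub_cancel]
    constructor
    · rw [h _ (by lia), show i + 1 + n - 1 = i + n by lia, ih.1]
    · intro k hk
      rw [h _ (by lia), ih.2 _ (by lia)]

theorem eq_sum_monomial {P : DiffOp F} {m : ℕ} (hP : ∀ k, m < k → P.coeff k = 0) :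
    P = ∑ i ∈ Finset.range (m + 1), mulOp (P.coeff i) * del ^ i := by
  refine ext fun k => ?_
  simp only [mulOp_mul_del_pow, coeff_sum, coeff_monomial, Finset.sum_ite_eq', Finset.mem_range]
  split_ifs with h
  · rfl
  · exact hP k (by lia)

/-- The leading coefficient of a product. -/
theorem coeff_mul_top {P Q : DiffOp F} {m n : ℕ} (hP : ∀ k, m < k → P.coeff k = 0)
    (hQ : ∀ k, n < k → Q.coeff k = 0) : (P * Q).coeff (m + n) = P.coeff m * Q.coeff n := by
  rw [eq_sum_monomial hP, Finset.sum_mul, coeff_sum, Finset.sum_range_succ, ← eq_sum_monomial hP]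
  simp only [mulOp_mul, smul_mul, coeff_smul]
  rw [(coeff_del_pow_mul hQ m).1, Finset.sum_eq_zero, zero_add]
  intro i hi
  rw [(coeff_del_pow_mul hQ i).2 _ (by have := Finset.mem_range.mp hi; lia), mul_zero]

/-! ### The adjoint -/

theorem adjoint_monomial (n : ℕ) (a : F) : (monomial n a).adjoint = (-del) ^ n * mulOp a := by
  refine Polynomial.sum_monomial_index (R := F) (S := DiffOp F) a
    (fun n a => (-del) ^ n * mulOp a) ?_
  rw [← mulOpHom_apply, map_zero, mul_zero]

theorem adjoint_add (P Q : DiffOp F) : (P + Q).adjoint = P.adjoint + Q.adjoint := by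
  refine Polynomial.sum_add_index (R := F) (S := DiffOp F) P Q
    (fun n a => (-del) ^ n * mulOp a) (fun n => ?_) fun n a b => ?_
  · rw [← mulOpHom_apply, map_zero, mul_zero]
  · simp only [← mulOpHom_apply, map_add, mul_add]

/-- The adjoint as an additive map. -/
def adjointHom : DiffOp F →+ DiffOp F := AddMonoidHom.mk' adjoint adjoint_add

theorem adjoint_zero : (0 : DiffOp F).adjoint = 0 := map_zero adjointHom

theorem adjoint_neg (P : DiffOp F) : (-P).adjoint = -P.adjoint := map_neg adjointHom P

theorem adjoint_sub (P Q : DiffOp F) : (P - Q).adjoint = P.adjoint - Q.adjoint :=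
  map_sub adjointHom P Q

theorem adjoint_sum {κ : Type*} (s : Finset κ) (P : κ → DiffOp F) :
    (∑ i ∈ s, P i).adjoint = ∑ i ∈ s, (P i).adjoint := map_sum adjointHom P s

theorem adjoint_mulOp (a : F) : (mulOp a).adjoint = mulOp a := by
  rw [mulOp, adjoint_monomial, pow_zero, one_mul, mulOp]

theorem adjoint_del : (del : DiffOp F).adjoint = -del := by
  rw [del, adjoint_monomial, pow_one]
  exact mul_one _

theorem adjoint_mulOp_mul (a : F) (P : DiffOp F) :
    (mulOp a * P).adjoint = P.adjoint * mulOp a := by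
  induction P using induction_on with
  | hadd P Q hP hQ => rw [mul_add, adjoint_add, hP, hQ, adjoint_add, add_mul]
  | hmon n b =>
    rw [mulOp_mul, smul_monomial, adjoint_monomial, adjoint_monomial, mul_assoc, mul_comm a]
    simp only [← mulOpHom_apply, map_mul]

theorem adjoint_del_mul (P : DiffOp F) : (del * P).adjoint = P.adjoint * -del := by
  induction P using induction_on with
  | hadd P Q hP hQ => rw [mul_add, adjoint_add, hP, hQ, adjoint_add, add_mul]
  | hmon n b =>
    rw [del_mul, dLeft_monomial, adjoint_add, adjoint_monomial, adjoint_monomial,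
      adjoint_monomial, pow_succ, mul_assoc, mul_assoc, ← mul_add, neg_mul, del_mul_mulOp, mul_neg]
    congr 1
    abel

theorem adjoint_mul (P Q : DiffOp F) : (P * Q).adjoint = Q.adjoint * P.adjoint := by
  induction P using induction_on with
  | hadd P R hP hR => rw [add_mul, adjoint_add, hP, hR, adjoint_add, mul_add]
  | hmon n a =>
    have h : ∀ Q : DiffOp F, (del ^ n * Q).adjoint = Q.adjoint * (-del) ^ n := by
      induction n with
      | zero => intro Q; simp
      | succ n ih =>
        intro Q
        rw [pow_succ, mul_assoc, ih, adjoint_del_mul, mul_assoc, ← pow_succ']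
    rw [adjoint_monomial, ← mulOp_mul_del_pow, mul_assoc, adjoint_mulOp_mul, h, mul_assoc]

theorem adjoint_adjoint (P : DiffOp F) : P.adjoint.adjoint = P := by
  induction P using induction_on with
  | hadd P Q hP hQ => rw [adjoint_add, adjoint_add, hP, hQ]
  | hmon n a =>
    have h : ((-del : DiffOp F) ^ n).adjoint = del ^ n := by
      induction n with
      | zero => rw [pow_zero, pow_zero]; exact adjoint_mulOp 1
      | succ n ih =>
        rw [pow_succ, adjoint_mul, ih, adjoint_neg, adjoint_del, neg_neg, ← pow_succ']
    rw [adjoint_monomial, adjoint_mul, h, adjoint_mulOp, mulOp_mul_del_pow]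

theorem coeff_adjoint {P : DiffOp F} {m : ℕ} (hP : ∀ k, m < k → P.coeff k = 0) :
    P.adjoint.coeff m = (-1) ^ m * P.coeff m ∧ ∀ k, m < k → P.adjoint.coeff k = 0 := by
  have h0 : ∀ a : F, ∀ k, 0 < k → (mulOp a).coeff k = 0 := fun a k hk => by
    rw [mulOp, coeff_monomial, if_neg hk.ne]
  have h1 : ∀ (a : F) (i k : ℕ), ((-del) ^ i * mulOp a).coeff k =
      (-1) ^ i * (del ^ i * mulOp a).coeff k := fun a i k => by
    rcases Nat.even_or_odd i with h | h
    · rw [h.neg_pow, h.neg_one_pow, one_mul]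
    · rw [h.neg_pow, h.neg_one_pow, neg_mul, coeff_neg, neg_one_mul]
  have h2 : P.adjoint = ∑ i ∈ Finset.range (m + 1), (-del) ^ i * mulOp (P.coeff i) := by
    conv_lhs => rw [eq_sum_monomial hP]
    simp only [mulOp_mul_del_pow, adjoint_sum, adjoint_monomial]
  have h3 : ∀ i ∈ Finset.range (m + 1), ∀ k, i < k →
      ((-del) ^ i * mulOp (P.coeff i)).coeff k = 0 := fun i _ k hik => by
    rw [h1, (coeff_del_pow_mul (h0 _) i).2 k (by simpa using hik), mul_zero]
  constructor
  · rw [h2, coeff_sum, Finset.sum_range_succ, Finset.sum_eq_zero, zero_add, h1]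
    · have := (coeff_del_pow_mul (h0 (P.coeff m)) m).1
      rw [add_zero] at this
      rw [this, mulOp, coeff_monomial, if_pos rfl]
    · intro i hi
      have him := Finset.mem_range.mp hi
      exact h3 i (Finset.mem_range.mpr (by lia)) m him
  · intro k hk
    rw [h2, coeff_sum, Finset.sum_eq_zero]
    intro i hi
    exact h3 i hi k (by have := Finset.mem_range.mp hi; lia)

end Algebra

end DiffOp
end

noncomputable section

/-! ### The dimension of the space of antisymmetric matrices -/

section Skew

variable (F ι : Type*) [Field F]

/-- The space of antisymmetric matrices. -/
def skewMatrices : Submodule F (Matrix ι ι F) where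
  carrier := {X | X.transpose = -X}
  add_mem' {X Y} hX hY := by
    have hX' : X.transpose = -X := hX
    have hY' : Y.transpose = -Y := hY
    change (X + Y).transpose = -(X + Y)
    rw [Matrix.transpose_add, hX', hY', neg_add]
  zero_mem' := by
    change (0 : Matrix ι ι F).transpose = -0
    simp
  smul_mem' c X hX := by
    have hX' : X.transpose = -X := hX
    change (c • X).transpose = -(c • X)
    rw [Matrix.transpose_smul, hX', smul_neg]

variable {F ι}

theorem mem_skewMatrices {X : Matrix ι ι F} : X ∈ skewMatrices F ι ↔ X.transpose = -X := Iff.rfl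

/-- An antisymmetric matrix is given by its entries above the diagonal. -/
def skewMatricesEquiv [CharZero F] [LinearOrder ι] :
    skewMatrices F ι ≃ₗ[F] ({p : ι × ι // p.1 < p.2} → F) where
  toFun X p := X.1 p.1.1 p.1.2
  map_add' _ _ := rfl
  map_smul' _ _ := rfl
  invFun f := ⟨Matrix.of fun i j =>
    if h : i < j then f ⟨(i, j), h⟩ else if h : j < i then -f ⟨(j, i), h⟩ else 0, by
      rw [mem_skewMatrices]
      ext i j
      rcases lt_trichotomy i j with h | rfl | h
      · simp [h, h.not_gt]
      · simp
      · simp [h, h.not_gt]⟩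
  left_inv X := by
    have hX : ∀ i j, X.1 j i = -X.1 i j := fun i j => congrFun (congrFun X.2 i) j
    ext i j
    rcases lt_trichotomy i j with h | rfl | h
    · simp [h]
    · simp [self_eq_neg.mp (hX i i)]
    · simp [h, h.not_gt, hX i j]
  right_inv f := by
    ext p
    simp [p.2]

/-- The off-diagonal pairs split into two halves exchanged by swapping coordinates. -/
theorem card_lt_pairs (ι : Type*) [Fintype ι] [LinearOrder ι] :
    Fintype.card {p : ι × ι // p.1 < p.2} = (Fintype.card ι).choose 2 := by
  have h1 : Fintype.card {p : ι × ι // p.2 < p.1} = Fintype.card {p : ι × ι // p.1 < p.2} :=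
    Fintype.card_congr ((Equiv.prodComm ι ι).subtypeEquiv fun _ => Iff.rfl)
  have h2 : (Finset.univ : Finset ι).offDiag =
      (Finset.univ.filter fun p : ι × ι => p.1 < p.2) ∪
        (Finset.univ.filter fun p : ι × ι => p.2 < p.1) := by
    ext p
    simp only [Finset.mem_offDiag, Finset.mem_univ, true_and, Finset.mem_union,
      Finset.mem_filter]
    exact ne_iff_lt_or_gt
  have h3 := congrArg Finset.card h2
  rw [Finset.card_union_of_disjoint, Finset.offDiag_card, ← Fintype.card_subtype,
    ← Fintype.card_subtype, h1, Finset.card_univ] at h3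
  · rw [Nat.choose_two_right, Nat.mul_sub_one, h3]
    lia
  · rw [Finset.disjoint_filter]
    exact fun p _ h => h.not_gt

theorem rank_skewMatrices [CharZero F] [Fintype ι] :
    Module.rank F (skewMatrices F ι) = ((Fintype.card ι).choose 2 : ℕ) := by
  -- Any order will do; it only gives meaning to being above the diagonal.
  let _ : LinearOrder ι := LinearOrder.lift' (Fintype.equivFin ι) (Equiv.injective _)
  rw [← card_lt_pairs, ← Module.finrank_eq_rank, skewMatricesEquiv.finrank_eq,
    Module.finrank_fintype_fun_eq_card]

end Skew

namespace MatDiffOp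

/-! ### Rectangular matrices of operators and their adjoints -/

section Rectangular

variable {F : Type*} [CommRing F] {m n p : Type*}

/-- The matrix of the coefficients of `∂ᵏ`. -/
def coeffMat (V : Matrix m n (DiffOp F)) (k : ℕ) : Matrix m n F := V.map fun P => P.coeff k

theorem coeffMat_apply (V : Matrix m n (DiffOp F)) (k : ℕ) (i : m) (j : n) :
    coeffMat V k i j = (V i j).coeff k := rfl

theorem coeff_eq_coeffMat {ℓ : ℕ} (P : MatDiffOp ℓ F) (k : ℕ) : P.coeff k = coeffMat P k := rfl

theorem ext_coeffMat {V W : Matrix m n (DiffOp F)} (h : ∀ k, coeffMat V k = coeffMat W k) :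
    V = W := by
  ext i j
  refine DiffOp.ext fun k => ?_
  exact congrFun (congrFun (h k) i) j

theorem coeffMat_sub (V W : Matrix m n (DiffOp F)) (k : ℕ) :
    coeffMat (V - W) k = coeffMat V k - coeffMat W k := by
  ext i j
  exact DiffOp.coeff_sub _ _ _

theorem coeffMat_zero (k : ℕ) : coeffMat (0 : Matrix m n (DiffOp F)) k = 0 := by
  ext i j
  exact DiffOp.coeff_zero k

theorem exists_orderLT {ℓ : ℕ} (P : MatDiffOp ℓ F) : ∃ k, P.OrderLT k := by
  choose f hf using fun i j => (P i j).exists_coeff_eq_zero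
  refine ⟨Finset.univ.sup fun q : Fin ℓ × Fin ℓ => f q.1 q.2, fun k hk => ?_⟩
  ext i j
  exact hf i j k ((Finset.le_sup (f := fun q : Fin ℓ × Fin ℓ => f q.1 q.2)
    (Finset.mem_univ (i, j))).trans hk)

theorem OrderLT.coeff_eq_zero {ℓ : ℕ} {P : MatDiffOp ℓ F} {k : ℕ} (hP : P.OrderLT (k + 1))
    (i j : Fin ℓ) (r : ℕ) (hr : k < r) : (P i j).coeff r = 0 :=
  congrFun (congrFun (hP r hr) i) j

theorem eq_zero_of_orderLT_zero {ℓ : ℕ} {P : MatDiffOp ℓ F} (hP : P.OrderLT 0) : P = 0 :=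
  ext_coeffMat fun k => (hP k (Nat.zero_le k)).trans (coeffMat_zero k).symm

variable [Differential F]

/-- A matrix over `F` as a matrix of operators of order `0`. -/
def ofMat (X : Matrix m n F) : Matrix m n (DiffOp F) := X.map DiffOp.mulOpHom

theorem ofMat_apply (X : Matrix m n F) (i : m) (j : n) : ofMat X i j = DiffOp.mulOp (X i j) := rfl

theorem ofMat_mul [Fintype n] (X : Matrix m n F) (Y : Matrix n p F) :
    ofMat (X * Y) = ofMat X * ofMat Y := Matrix.map_mul

theorem ofMat_add (X Y : Matrix m n F) : ofMat (X + Y) = ofMat X + ofMat Y := by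
  ext i j
  exact map_add DiffOp.mulOpHom _ _

theorem ofMat_sub (X Y : Matrix m n F) : ofMat (X - Y) = ofMat X - ofMat Y := by
  ext i j
  exact map_sub DiffOp.mulOpHom _ _

theorem ofMat_neg (X : Matrix m n F) : ofMat (-X) = -ofMat X := by
  ext i j
  exact map_neg DiffOp.mulOpHom _

theorem ofMat_zero : ofMat (0 : Matrix m n F) = 0 := by
  ext i j
  exact map_zero DiffOp.mulOpHom

theorem coeffMat_ofMat_mul [Fintype n] (X : Matrix m n F) (V : Matrix n p (DiffOp F)) (k : ℕ) :
    coeffMat (ofMat X * V) k = X * coeffMat V k := by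
  ext i j
  simp only [coeffMat_apply, Matrix.mul_apply, ofMat_apply, DiffOp.coeff_sum, DiffOp.mulOp_mul,
    DiffOp.coeff_smul]

/-- The scalar matrix `∂`. -/
def delMat (F m : Type*) [CommRing F] [Differential F] [DecidableEq m] : Matrix m m (DiffOp F) := Matrix.diagonal fun _ => DiffOp.del

/-- The entrywise derivative. -/
def derivMat (X : Matrix m n F) : Matrix m n F := X.map fun a => a′

theorem derivMat_apply (X : Matrix m n F) (i : m) (j : n) : derivMat X i j = (X i j)′ := rfl

theorem delMat_mul_ofMat [Fintype m] [Fintype n] [DecidableEq m] [DecidableEq n]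
    (X : Matrix m n F) :
    delMat F m * ofMat X = ofMat X * delMat F n + ofMat (derivMat X) := by
  ext i j
  rw [delMat, Matrix.diagonal_mul, Matrix.add_apply, delMat, Matrix.mul_diagonal, ofMat_apply,
    ofMat_apply, DiffOp.del_mul_mulOp, derivMat_apply]

/-- The adjoint of a rectangular matrix of operators. -/
def adj (V : Matrix m n (DiffOp F)) : Matrix n m (DiffOp F) :=
  Matrix.of fun i j => (V j i).adjoint

theorem adj_apply (V : Matrix m n (DiffOp F)) (i : n) (j : m) : adj V i j = (V j i).adjoint := rfl

theorem adjoint_eq_adj {ℓ : ℕ} (P : MatDiffOp ℓ F) : P.adjoint = adj P := rfl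

theorem adj_mul [Fintype n] (V : Matrix m n (DiffOp F)) (W : Matrix n p (DiffOp F)) :
    adj (V * W) = adj W * adj V := by
  ext i j
  simp only [adj_apply, Matrix.mul_apply, DiffOp.adjoint_sum, DiffOp.adjoint_mul]

theorem adj_adj (V : Matrix m n (DiffOp F)) : adj (adj V) = V := by
  ext i j
  exact DiffOp.adjoint_adjoint _

theorem adj_add (V W : Matrix m n (DiffOp F)) : adj (V + W) = adj V + adj W := by
  ext i j
  exact DiffOp.adjoint_add _ _

theorem adj_sub (V W : Matrix m n (DiffOp F)) : adj (V - W) = adj V - adj W := by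
  ext i j
  exact DiffOp.adjoint_sub _ _

theorem adj_neg (V : Matrix m n (DiffOp F)) : adj (-V) = -adj V := by
  ext i j
  exact DiffOp.adjoint_neg _

theorem adj_ofMat (X : Matrix m n F) : adj (ofMat X) = ofMat X.transpose := by
  ext i j
  exact DiffOp.adjoint_mulOp _

theorem adj_delMat [DecidableEq m] :
    adj (delMat F m : Matrix m m (DiffOp F)) = -delMat F m := by
  ext i j
  rw [adj_apply, Matrix.neg_apply, delMat]
  by_cases h : i = j
  · subst h
    rw [Matrix.diagonal_apply_eq, DiffOp.adjoint_del]
  · rw [Matrix.diagonal_apply_ne _ h, Matrix.diagonal_apply_ne' _ h, DiffOp.adjoint_zero, neg_zero]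

end Rectangular

/-! ### Right division by an operator with invertible leading coefficient -/

section Division

variable {F : Type*} [Field F] [Differential F] {ℓ N : ℕ} {L : MatDiffOp ℓ F}

theorem coeff_mul_top {P Q : MatDiffOp ℓ F} {m n : ℕ} (hP : P.OrderLT (m + 1))
    (hQ : Q.OrderLT (n + 1)) : coeff (P * Q) (m + n) = P.coeff m * Q.coeff n := by
  ext i j
  simp only [coeff_eq_coeffMat, coeffMat_apply, Matrix.mul_apply, DiffOp.coeff_sum]
  exact Finset.sum_congr rfl fun k _ =>
    DiffOp.coeff_mul_top (hP.coeff_eq_zero i k) (hQ.coeff_eq_zero k j)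

theorem coeff_adjoint {P : MatDiffOp ℓ F} {m : ℕ} (hP : P.OrderLT (m + 1)) :
    P.adjoint.coeff m = (-1 : F) ^ m • (P.coeff m).transpose ∧ P.adjoint.OrderLT (m + 1) := by
  constructor
  · ext i j
    exact (DiffOp.coeff_adjoint (hP.coeff_eq_zero j i)).1
  · intro r hr
    ext i j
    exact (DiffOp.coeff_adjoint (hP.coeff_eq_zero j i)).2 r hr

theorem isUnit_coeff_adjoint (hL : L.OrderLT (N + 1)) (hu : IsUnit (L.coeff N)) :
    IsUnit (L.adjoint.coeff N) := by
  rw [(coeff_adjoint hL).1]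
  have h1 : IsUnit (L.coeff N).transpose := (Matrix.isUnit_transpose _).mpr hu
  have h2 : IsUnit ((-1 : F) ^ N) := (isUnit_one.neg).pow N
  rw [Matrix.isUnit_iff_isUnit_det, Matrix.det_smul]
  exact (h2.pow _).mul ((Matrix.isUnit_iff_isUnit_det _).mp h1)

/-- Right division with remainder. -/
theorem exists_sub_mul_orderLT (hL : L.OrderLT (N + 1)) (hu : IsUnit (L.coeff N))
    (T : MatDiffOp ℓ F) : ∃ Q : MatDiffOp ℓ F, OrderLT (T - Q * L) N := by
  obtain ⟨k, hk⟩ := T.exists_orderLT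
  have hk' : T.OrderLT (N + k) := fun r hr => hk r (by lia)
  clear hk
  induction k generalizing T with
  | zero => exact ⟨0, by simpa using hk'⟩
  | succ i ih =>
    -- `C` is chosen so that C ∂ⁱ L has the same coefficient at ∂ᴺ⁺ⁱ as `T`; subtracting it lowers
    -- the order bound by one.
    let C : Matrix (Fin ℓ) (Fin ℓ) F := T.coeff (N + i) * (L.coeff N)⁻¹
    let V : MatDiffOp ℓ F := delMat F (Fin ℓ) ^ i * L
    have hV : ∀ a b, V a b = DiffOp.del ^ i * L a b := fun a b => by
      simp only [V, delMat, Matrix.diagonal_pow, Matrix.diagonal_mul, Pi.pow_apply]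
    have hV1 : V.coeff (N + i) = L.coeff N := by
      ext a b
      rw [coeff_eq_coeffMat, coeffMat_apply, hV, add_comm,
        (DiffOp.coeff_del_pow_mul (hL.coeff_eq_zero a b) i).1]
      rfl
    have hV2 : V.OrderLT (N + i + 1) := fun r hr => by
      ext a b
      rw [coeff_eq_coeffMat, coeffMat_apply, hV,
        (DiffOp.coeff_del_pow_mul (hL.coeff_eq_zero a b) i).2 r (by lia)]
      rfl
    obtain ⟨Q, hQ⟩ := ih (T - ofMat C * V) fun r hr => by
      rw [coeff_eq_coeffMat, coeffMat_sub, coeffMat_ofMat_mul, ← coeff_eq_coeffMat,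
        ← coeff_eq_coeffMat]
      rcases hr.eq_or_lt with rfl | hr
      · rw [hV1, Matrix.mul_assoc, Matrix.nonsing_inv_mul _ ((Matrix.isUnit_iff_isUnit_det _).mp hu),
          Matrix.mul_one, sub_self]
      · rw [hk' r (by lia), hV2 r (by lia), Matrix.mul_zero, sub_zero]
    refine ⟨Q + ofMat C * delMat F (Fin ℓ) ^ i, ?_⟩
    have : T - (Q + ofMat C * delMat F (Fin ℓ) ^ i) * L = T - ofMat C * V - Q * L := by
      rw [add_mul, mul_assoc]
      abel
    rw [this]
    exact hQ

/-- The top coefficient of `Q * L` is that of `Q` times an invertible matrix, so the order bound on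
`Q` can be lowered until nothing is left. -/
theorem eq_zero_of_mul_orderLT (hL : L.OrderLT (N + 1)) (hu : IsUnit (L.coeff N))
    {Q : MatDiffOp ℓ F} (hQ : OrderLT (Q * L) N) : Q = 0 := by
  obtain ⟨k, hk⟩ := Q.exists_orderLT
  induction k with
  | zero => exact eq_zero_of_orderLT_zero hk
  | succ k ih =>
    refine ih fun r hr => ?_
    rcases hr.eq_or_lt with rfl | hr
    · have h := coeff_mul_top hk hL
      rw [hQ _ (by lia)] at h
      exact (hu.mul_left_eq_zero).mp h.symm
    · exact hk r hr

end Division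

end MatDiffOp
end

noncomputable section

namespace DiffOp

variable {F : Type*} [CommRing F]

/-- The operator `∑ aₖ₊ₙ ∂ⁿ` for `P = ∑ aₙ ∂ⁿ`. -/
def shift (k : ℕ) (P : DiffOp F) : DiffOp F := (Polynomial.divX (R := F))^[k] P

theorem coeff_shift (k : ℕ) (P : DiffOp F) (n : ℕ) : (shift k P).coeff n = P.coeff (k + n) := by
  induction k generalizing n with
  | zero => rw [Nat.zero_add]; rfl
  | succ k ih =>
    have h : (shift (k + 1) P).coeff n = (shift k P).coeff (n + 1) := by
      have : shift (k + 1) P = Polynomial.divX (R := F) (shift k P) :=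
        Function.iterate_succ_apply' (Polynomial.divX (R := F)) k P
      rw [this]
      exact Polynomial.coeff_divX
    rw [h, ih, show k + (n + 1) = k + 1 + n by lia]

variable [Differential F]

theorem shift_succ_mul_del (k : ℕ) (P : DiffOp F) :
    shift (k + 1) P * del + mulOp (P.coeff k) = shift k P := by
  refine ext fun n => ?_
  rw [coeff_add, mulOp, coeff_monomial, coeff_shift]
  cases n with
  | zero => rw [coeff_mul_del_zero, if_pos rfl, zero_add, add_zero]
  | succ n =>
    rw [coeff_mul_del_succ, if_neg (by lia), add_zero, coeff_shift,
      show k + 1 + n = k + (n + 1) by lia]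

end DiffOp

/-! ### The companion system and the fundamental identity -/

namespace MatDiffOp

variable {F : Type*} [Field F] {ℓ M : ℕ}

/-- The matrix of the embedding of `Fˡ` as the block `k`. -/
def blockIncl (F : Type*) [Field F] (ℓ : ℕ) {M : ℕ} (k : Fin (M + 1)) :
    Matrix (Fin (M + 1) × Fin ℓ) (Fin ℓ) F :=
  Matrix.of fun p b => if p = (k, b) then 1 else 0

theorem blockIncl_apply (k : Fin (M + 1)) (p : Fin (M + 1) × Fin ℓ) (b : Fin ℓ) :
    blockIncl F ℓ k p b = if p = (k, b) then 1 else 0 := rfl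

theorem transpose_blockIncl_mul {n : Type*} (k : Fin (M + 1))
    (X : Matrix (Fin (M + 1) × Fin ℓ) n F) (a : Fin ℓ) (q : n) :
    ((blockIncl F ℓ k).transpose * X) a q = X (k, a) q := by
  simp [Matrix.mul_apply, blockIncl_apply]

theorem blockIncl_mul {n : Type*} (k : Fin (M + 1)) (X : Matrix (Fin ℓ) n F)
    (p : Fin (M + 1) × Fin ℓ) (q : n) :
    (blockIncl F ℓ k * X) p q = if p.1 = k then X p.2 q else 0 := by
  obtain ⟨i, a⟩ := p
  by_cases h : i = k
  · simp [Matrix.mul_apply, blockIncl_apply, h]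
  · simp [Matrix.mul_apply, blockIncl_apply, h]

/-- The block companion matrix of `K`, of the system `y′ = A y` equivalent to `K u = 0`. -/
def companion (M : ℕ) (K : MatDiffOp ℓ F) :
    Matrix (Fin (M + 1) × Fin ℓ) (Fin (M + 1) × Fin ℓ) F :=
  Matrix.of fun p q =>
    if p.1 = Fin.last M then -((K.coeff (M + 1))⁻¹ * K.coeff q.1) p.2 q.2
    else if (q.1 : ℕ) = p.1 + 1 ∧ q.2 = p.2 then 1 else 0

theorem companion_last (K : MatDiffOp ℓ F) (a : Fin ℓ) (q : Fin (M + 1) × Fin ℓ) :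
    companion M K (Fin.last M, a) q = -((K.coeff (M + 1))⁻¹ * K.coeff q.1) a q.2 := by
  simp [companion]

theorem companion_castSucc (K : MatDiffOp ℓ F) (k : Fin M) (a : Fin ℓ)
    (q : Fin (M + 1) × Fin ℓ) :
    companion M K (k.castSucc, a) q = if q = (k.succ, a) then 1 else 0 := by
  obtain ⟨j, b⟩ := q
  simp [companion, Fin.ext_iff, k.2.ne]

theorem companion_mul_castSucc {n : Type*} (K : MatDiffOp ℓ F)
    (X : Matrix (Fin (M + 1) × Fin ℓ) n F) (k : Fin M) (a : Fin ℓ) (q : n) :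
    (companion M K * X) (k.castSucc, a) q = X (k.succ, a) q := by
  simp [Matrix.mul_apply, companion_castSucc]

/-- The row of the operators `∑ Kₖ₊₁₊ₙ ∂ⁿ`, `k ≤ M`. -/
def hornerRow (M : ℕ) (K : MatDiffOp ℓ F) :
    Matrix (Fin ℓ) (Fin (M + 1) × Fin ℓ) (DiffOp F) :=
  Matrix.of fun b p => (K b p.2).shift (p.1 + 1)

theorem hornerRow_apply (K : MatDiffOp ℓ F) (b : Fin ℓ) (p : Fin (M + 1) × Fin ℓ) :
    hornerRow M K b p = (K b p.2).shift (p.1 + 1) := rfl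

theorem hornerRow_last {K : MatDiffOp ℓ F} (hK : K.OrderLT (M + 2)) (b a : Fin ℓ) :
    hornerRow M K b (Fin.last M, a) = DiffOp.mulOp (K.coeff (M + 1) b a) := by
  refine DiffOp.ext fun n => ?_
  rw [hornerRow_apply, DiffOp.coeff_shift, DiffOp.mulOp, DiffOp.coeff_monomial]
  split_ifs with h
  · subst h; rfl
  · refine hK.coeff_eq_zero _ _ _ ?_
    change M + 1 < M + 1 + n
    lia

variable [Differential F]

/-- The adjoint column of `hornerRow`. -/
def hornerCol (M : ℕ) (K : MatDiffOp ℓ F) :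
    Matrix (Fin (M + 1) × Fin ℓ) (Fin ℓ) (DiffOp F) := adj (hornerRow M K)

/-- The shifting rows of the companion matrix move entry k - 1 of `hornerRow` to column k. The last
row meets the entry K_{M+1}, which cancels the inverse in it and leaves -Kₖ. -/
theorem hornerRow_mul_companion {K : MatDiffOp ℓ F} (hK : K.OrderLT (M + 2))
    (hu : IsUnit (K.coeff (M + 1))) (b : Fin ℓ) (q : Fin (M + 1) × Fin ℓ) :
    (hornerRow M K * ofMat (companion M K)) b q =
      (if q.1 = 0 then 0 else (K b q.2).shift q.1) - DiffOp.mulOp (K.coeff q.1 b q.2) := by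
  obtain ⟨k, c⟩ := q
  rw [Matrix.mul_apply, Fintype.sum_prod_type, Fin.sum_univ_castSucc, sub_eq_add_neg]
  congr 1
  · simp only [ofMat_apply, companion_castSucc, hornerRow_apply]
    induction k using Fin.cases with
    | zero =>
      rw [if_pos rfl]
      refine Finset.sum_eq_zero fun i _ => Finset.sum_eq_zero fun a _ => ?_
      rw [if_neg (by simp [Prod.ext_iff, Fin.ext_iff]), DiffOp.mulOp_zero, mul_zero]
    | succ j =>
      rw [if_neg (Fin.succ_ne_zero j), Finset.sum_eq_single j, Finset.sum_eq_single c]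
      · rw [if_pos rfl, DiffOp.mulOp_one, mul_one]
        rfl
      · intro a _ ha
        rw [if_neg (by simp [Prod.ext_iff, ha.symm]), DiffOp.mulOp_zero, mul_zero]
      · exact fun h => absurd (Finset.mem_univ _) h
      · intro i _ hi
        refine Finset.sum_eq_zero fun a _ => ?_
        rw [if_neg (by simp [Prod.ext_iff, hi.symm]), DiffOp.mulOp_zero, mul_zero]
      · exact fun h => absurd (Finset.mem_univ _) h
  · simp only [ofMat_apply, companion_last, hornerRow_last hK, ← DiffOp.mulOpHom_apply, ← map_mul,
      ← map_sum, ← map_neg, mul_neg, Finset.sum_neg_distrib]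
    rw [← Matrix.mul_apply, ← Matrix.mul_assoc,
      Matrix.mul_nonsing_inv _ ((Matrix.isUnit_iff_isUnit_det _).mp hu), Matrix.one_mul]

/-- The first-order form of `K`. -/
theorem hornerRow_mul_delMat {K : MatDiffOp ℓ F} (hK : K.OrderLT (M + 2))
    (hu : IsUnit (K.coeff (M + 1))) :
    hornerRow M K * delMat F (Fin (M + 1) × Fin ℓ) =
      hornerRow M K * ofMat (companion M K) + K * ofMat (blockIncl F ℓ (0 : Fin (M + 1))).transpose := by
  ext b q
  rw [Matrix.add_apply, hornerRow_mul_companion hK hu, delMat, Matrix.mul_diagonal]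
  have h1 : (K * ofMat (blockIncl F ℓ (0 : Fin (M + 1))).transpose) b q =
      if q.1 = 0 then K b q.2 else 0 := by
    obtain ⟨k, c⟩ := q
    simp only [Matrix.mul_apply, ofMat_apply, Matrix.transpose_apply, blockIncl_apply]
    by_cases hk : k = 0
    · subst hk
      rw [Finset.sum_eq_single c, if_pos rfl, if_pos rfl, DiffOp.mulOp_one, mul_one]
      · intro d _ hd
        rw [if_neg (by simp [hd.symm]), DiffOp.mulOp_zero, mul_zero]
      · exact fun h => absurd (Finset.mem_univ _) h
    · rw [if_neg hk]
      refine Finset.sum_eq_zero fun d _ => ?_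
      rw [if_neg (by simp [hk]), DiffOp.mulOp_zero, mul_zero]
  -- Horner recursion: Hₖ ∂ is the k-th shift of K without its constant term Kₖ. Column 0 is the
  -- only one in which the shift is K itself and is not supplied by H A.
  have h2 := DiffOp.shift_succ_mul_del q.1 (K b q.2)
  rw [h1, hornerRow_apply, eq_sub_of_add_eq h2]
  by_cases hk : q.1 = 0
  · rw [if_pos hk, if_pos hk, hk]
    change K b q.2 - _ = _
    rw [zero_sub, neg_add_eq_sub]
    rfl
  · rw [if_neg hk, if_neg hk, add_zero]
    rfl

theorem delMat_mul_hornerCol {K : MatDiffOp ℓ F} (hK : K.OrderLT (M + 2))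
    (hu : IsUnit (K.coeff (M + 1))) :
    delMat F (Fin (M + 1) × Fin ℓ) * hornerCol M K =
      -(ofMat (companion M K).transpose * hornerCol M K + ofMat (blockIncl F ℓ (0 : Fin (M + 1))) * K.adjoint) := by
  have h := congrArg adj (hornerRow_mul_delMat hK hu)
  rw [adj_mul, adj_add, adj_mul, adj_mul, adj_delMat, adj_ofMat, adj_ofMat,
    Matrix.transpose_transpose, Matrix.neg_mul] at h
  rw [adjoint_eq_adj, hornerCol, ← h, neg_neg]

/-- The connection `X ↦ X′ - A X - X Aᵀ`. -/
def bracketConn {ι : Type*} [Fintype ι] (A : Matrix ι ι F) : Matrix ι ι F →+ Matrix ι ι F where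
  toFun X := derivMat X - A * X - X * A.transpose
  map_zero' := by
    ext i j
    simp [derivMat_apply]
  map_add' X Y := by
    have : derivMat (X + Y) = derivMat X + derivMat Y := by
      ext i j
      exact Derivation.map_add _ _ _
    rw [this, Matrix.mul_add, Matrix.add_mul]
    abel

theorem bracketConn_apply {ι : Type*} [Fintype ι] (A X : Matrix ι ι F) :
    bracketConn A X = derivMat X - A * X - X * A.transpose := rfl

theorem isConnection_bracketConn {ι : Type*} [Fintype ι] (A : Matrix ι ι F) :
    IsConnection F (bracketConn A) := fun c X => by
  have : derivMat (c • X) = c′ • X + c • derivMat X := by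
    ext i j
    simp only [derivMat_apply, Matrix.smul_apply, Matrix.add_apply, smul_eq_mul,
      Derivation.leibniz]
    ring
  rw [bracketConn_apply, bracketConn_apply, this, Matrix.mul_smul, Matrix.smul_mul, smul_sub,
    smul_sub]
  abel

/-- This makes the antisymmetric matrices stable under the connection. -/
theorem transpose_bracketConn {ι : Type*} [Fintype ι] (A X : Matrix ι ι F) :
    (bracketConn A X).transpose = bracketConn A X.transpose := by
  rw [bracketConn_apply, bracketConn_apply, Matrix.transpose_sub, Matrix.transpose_sub,
    Matrix.transpose_mul, Matrix.transpose_mul, Matrix.transpose_transpose, sub_right_comm]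
  rfl

/-- The operator `∑ⱼ X₀ⱼ Yⱼ` of a block matrix `X`, where `Y` is `hornerCol`. -/
def ofBlocks (K : MatDiffOp ℓ F) (X : Matrix (Fin (M + 1) × Fin ℓ) (Fin (M + 1) × Fin ℓ) F) :
    MatDiffOp ℓ F :=
  ofMat ((blockIncl F ℓ (0 : Fin (M + 1))).transpose * X) * hornerCol M K

theorem adjoint_ofBlocks (K : MatDiffOp ℓ F)
    (X : Matrix (Fin (M + 1) × Fin ℓ) (Fin (M + 1) × Fin ℓ) F) :
    (ofBlocks K X).adjoint = hornerRow M K * ofMat (X.transpose * blockIncl F ℓ (0 : Fin (M + 1))) := by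
  rw [adjoint_eq_adj, ofBlocks, adj_mul, adj_ofMat, Matrix.transpose_mul,
    Matrix.transpose_transpose, hornerCol, adj_adj]

/-- The fundamental identity. -/
theorem mul_ofBlocks {K : MatDiffOp ℓ F} (hK : K.OrderLT (M + 2))
    (hu : IsUnit (K.coeff (M + 1)))
    (X : Matrix (Fin (M + 1) × Fin ℓ) (Fin (M + 1) × Fin ℓ) F) :
    K * ofBlocks K X = hornerRow M K * (ofMat (bracketConn (companion M K) X) * hornerCol M K) -
      (ofBlocks K X.transpose).adjoint * K.adjoint := by
  have h1 := hornerRow_mul_delMat hK hu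
  have h2 := delMat_mul_hornerCol hK hu
  -- K e₀ᵀ X Y = H(∂ - A)XY = H(X′ - AX)Y + HX∂Y, and ∂Y = -AᵀY - e₀K^* produces both the missing
  -- term of the connection and the adjoint term.
  rw [adjoint_ofBlocks, Matrix.transpose_transpose, ofBlocks, ofMat_mul, ← Matrix.mul_assoc,
    ← Matrix.mul_assoc, ← sub_eq_of_eq_add' h1, ← Matrix.mul_sub, Matrix.mul_assoc,
    Matrix.mul_assoc, Matrix.sub_mul, ← Matrix.mul_assoc (delMat F (Fin (M + 1) × Fin ℓ)), delMat_mul_ofMat,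
    Matrix.add_mul, Matrix.mul_assoc (ofMat X), h2, bracketConn_apply, ofMat_sub, ofMat_sub,
    ofMat_mul, ofMat_mul, ofMat_mul, Matrix.mul_assoc, ← Matrix.mul_sub]
  congr 1
  simp only [Matrix.sub_mul, Matrix.mul_neg, Matrix.mul_add, Matrix.mul_assoc]
  abel

theorem ofBlocks_neg (K : MatDiffOp ℓ F)
    (X : Matrix (Fin (M + 1) × Fin ℓ) (Fin (M + 1) × Fin ℓ) F) :
    ofBlocks K (-X) = -ofBlocks K X := by
  rw [ofBlocks, Matrix.mul_neg, ofMat_neg, Matrix.neg_mul, ofBlocks]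

theorem mul_ofBlocks_of_skew {K : MatDiffOp ℓ F} (hK : K.OrderLT (M + 2))
    (hu : IsUnit (K.coeff (M + 1)))
    {X : Matrix (Fin (M + 1) × Fin ℓ) (Fin (M + 1) × Fin ℓ) F} (hX : X.transpose = -X) :
    K * ofBlocks K X = hornerRow M K * (ofMat (bracketConn (companion M K) X) * hornerCol M K) +
      (ofBlocks K X).adjoint * K.adjoint := by
  rw [mul_ofBlocks hK hu, hX, ofBlocks_neg, adjoint_eq_adj, adj_neg, Matrix.neg_mul, sub_neg_eq_add]
  rfl

/-! ### Coordinates with respect to `hornerCol` -/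

/-- Block k of `hornerCol` has order at most M - k with leading coefficient ±K_{M+1}ᵀ, so the orders
drop strictly from block to block. -/
theorem coeff_hornerCol {K : MatDiffOp ℓ F} (hK : K.OrderLT (M + 2))
    (p : Fin (M + 1) × Fin ℓ) (b : Fin ℓ) :
    (hornerCol M K p b).coeff (M - p.1) = (-1) ^ (M - (p.1 : ℕ)) * K.coeff (M + 1) b p.2 ∧
      ∀ k, M - (p.1 : ℕ) < k → (hornerCol M K p b).coeff k = 0 := by
  have h := DiffOp.coeff_adjoint (P := hornerRow M K b p) (m := M - p.1) fun k hk => by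
    rw [hornerRow_apply, DiffOp.coeff_shift]
    exact hK.coeff_eq_zero _ _ _ (by lia)
  refine ⟨?_, h.2⟩
  rw [hornerCol, adj_apply, h.1, hornerRow_apply, DiffOp.coeff_shift,
    show (p.1 : ℕ) + 1 + (M - p.1) = M + 1 by have := p.1.2; lia]
  rfl

/-- The coefficients of `hornerCol`, as a square matrix. -/
def hornerCoeff (M : ℕ) (K : MatDiffOp ℓ F) :
    Matrix (Fin (M + 1) × Fin ℓ) (Fin (M + 1) × Fin ℓ) F :=
  Matrix.of fun p q => (hornerCol M K p q.2).coeff q.1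

theorem isUnit_hornerCoeff {K : MatDiffOp ℓ F} (hK : K.OrderLT (M + 2))
    (hu : IsUnit (K.coeff (M + 1))) : IsUnit (hornerCoeff M K) := by
  rw [← Matrix.vecMul_injective_iff_isUnit]
  refine (injective_iff_map_eq_zero (Matrix.vecMulLinear (hornerCoeff M K))).mpr fun v hv => ?_
  suffices h : ∀ k : ℕ, ∀ hk : k < M + 1, (fun c => v (⟨k, hk⟩, c)) = 0 by
    funext p
    exact congrFun (h p.1 p.1.2) p.2
  intro k
  induction k using Nat.strong_induction_on with
  | _ k ih =>
    intro hk
    refine Matrix.mulVec_injective_of_isUnit hu ?_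
    rw [Matrix.mulVec_zero]
    funext b
    -- The coefficient of ∂ᴹ⁻ᵏ isolates block k: earlier blocks of `v` vanish by induction, and
    -- later blocks of `hornerCol` have too small an order.
    have h := congrFun hv (⟨M - k, by lia⟩, b)
    simp only [Matrix.vecMulLinear_apply, Matrix.vecMul, dotProduct, hornerCoeff,
      Matrix.of_apply, Fintype.sum_prod_type, Pi.zero_apply] at h
    rw [Finset.sum_eq_single (⟨k, hk⟩ : Fin (M + 1))] at h
    · have h' : (-1) ^ (M - k) * ∑ c, K.coeff (M + 1) b c * v (⟨k, hk⟩, c) = 0 := by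
        rw [← h, Finset.mul_sum]
        refine Finset.sum_congr rfl fun c _ => ?_
        have := (coeff_hornerCol hK (⟨k, hk⟩, c) b).1
        simp only at this
        rw [this]
        ring
      exact (mul_eq_zero.mp h').resolve_left (pow_ne_zero _ (neg_ne_zero.mpr one_ne_zero))
    · intro j _ hj
      refine Finset.sum_eq_zero fun c _ => ?_
      rcases lt_or_gt_of_ne (fun h => hj (Fin.ext h) : (j : ℕ) ≠ k) with hlt | hgt
      · have := congrFun (ih j hlt j.2) c
        simp only [Pi.zero_apply] at this
        rw [show (⟨(j : ℕ), j.2⟩ : Fin (M + 1)) = j from rfl] at this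
        rw [this, zero_mul]
      · rw [(coeff_hornerCol hK (j, c) b).2 _ (by have := j.2; simp only; lia), mul_zero]
    · exact fun h => absurd (Finset.mem_univ _) h

theorem coeff_ofMat_mul_hornerCol (K : MatDiffOp ℓ F)
    (x : Matrix (Fin ℓ) (Fin (M + 1) × Fin ℓ) F) (a : Fin ℓ) (q : Fin (M + 1) × Fin ℓ) :
    ((ofMat x * hornerCol M K) a q.2).coeff q.1 = (x * hornerCoeff M K) a q :=
  congrFun (congrFun (coeffMat_ofMat_mul x (hornerCol M K) q.1) a) q.2

theorem ofMat_mul_hornerCol_orderLT {K : MatDiffOp ℓ F} (hK : K.OrderLT (M + 2))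
    (x : Matrix (Fin ℓ) (Fin (M + 1) × Fin ℓ) F) :
    OrderLT (ofMat x * hornerCol M K) (M + 1) := fun k hk => by
  rw [coeff_eq_coeffMat, coeffMat_ofMat_mul]
  have : coeffMat (hornerCol M K) k = 0 := by
    ext p b
    exact (coeff_hornerCol hK p b).2 k (by lia)
  rw [this, Matrix.mul_zero]

theorem ofMat_mul_hornerCol_injective {K : MatDiffOp ℓ F} (hK : K.OrderLT (M + 2))
    (hu : IsUnit (K.coeff (M + 1))) {x : Matrix (Fin ℓ) (Fin (M + 1) × Fin ℓ) F}
    (hx : ofMat x * hornerCol M K = 0) : x = 0 := by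
  have h : x * hornerCoeff M K = 0 := by
    ext a q
    rw [← coeff_ofMat_mul_hornerCol, hx]
    exact DiffOp.coeff_zero _
  have hd := (Matrix.isUnit_iff_isUnit_det _).mp (isUnit_hornerCoeff hK hu)
  rw [← Matrix.mul_nonsing_inv_cancel_right _ x hd, h, Matrix.zero_mul]

theorem exists_eq_ofMat_mul_hornerCol {K : MatDiffOp ℓ F} (hK : K.OrderLT (M + 2))
    (hu : IsUnit (K.coeff (M + 1))) {P : MatDiffOp ℓ F} (hP : P.OrderLT (M + 1)) :
    ∃ x : Matrix (Fin ℓ) (Fin (M + 1) × Fin ℓ) F, P = ofMat x * hornerCol M K := by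
  have hd := (Matrix.isUnit_iff_isUnit_det _).mp (isUnit_hornerCoeff hK hu)
  let R : Matrix (Fin ℓ) (Fin (M + 1) × Fin ℓ) F := Matrix.of fun a q => (P a q.2).coeff q.1
  refine ⟨R * (hornerCoeff M K)⁻¹, ext_coeffMat fun k => ?_⟩
  by_cases hk : M + 1 ≤ k
  · have h1 := hP k hk
    have h2 := ofMat_mul_hornerCol_orderLT hK (R * (hornerCoeff M K)⁻¹) k hk
    rw [coeff_eq_coeffMat] at h1 h2
    rw [h1, h2]
  · ext a b
    have h := coeff_ofMat_mul_hornerCol K (R * (hornerCoeff M K)⁻¹) a (⟨k, by lia⟩, b)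
    rw [Matrix.nonsing_inv_mul_cancel_right _ _ hd] at h
    exact h.symm

/-- Hence a derivative concentrated in the last block row contributes only an operator of order at
most `M` to the fundamental identity. -/
theorem hornerRow_mul_blockIncl_last {K : MatDiffOp ℓ F} (hK : K.OrderLT (M + 2)) :
    hornerRow M K * ofMat (blockIncl F ℓ (Fin.last M)) = ofMat (K.coeff (M + 1)) := by
  ext a b
  rw [Matrix.mul_apply, Finset.sum_eq_single (Fin.last M, b)]
  · rw [ofMat_apply, blockIncl_apply, if_pos rfl, hornerRow_last hK, DiffOp.mulOp_one, mul_one]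
    rfl
  · intro p _ hp
    rw [ofMat_apply, blockIncl_apply, if_neg hp, DiffOp.mulOp_zero, mul_zero]
  · exact fun h => absurd (Finset.mem_univ _) h

end MatDiffOp
end

noncomputable section

namespace MatDiffOp

/-! ### Solving the operator equation and identifying the selfadjoint products -/

section SkewConnection

variable {F : Type*} [Field F] [Differential F] {ι : Type*} [Fintype ι]

/-- The restriction of `bracketConn` to antisymmetric matrices. -/
def skewConn (A : Matrix ι ι F) : skewMatrices F ι →+ skewMatrices F ι where
  toFun X := ⟨bracketConn A X, by
    rw [mem_skewMatrices, transpose_bracketConn, X.2, map_neg]⟩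
  map_zero' := Subtype.ext (map_zero (bracketConn A))
  map_add' X Y := Subtype.ext (map_add (bracketConn A) X.1 Y.1)

theorem isConnection_skewConn (A : Matrix ι ι F) : IsConnection F (skewConn A) := fun c X =>
  Subtype.ext (isConnection_bracketConn A c X.1)

end SkewConnection

variable {F : Type*} [Field F] [Differential F] {ℓ M : ℕ}

theorem adjoint_mul (P Q : MatDiffOp ℓ F) : adjoint (P * Q) = Q.adjoint * P.adjoint := adj_mul P Q

theorem adjoint_adjoint (P : MatDiffOp ℓ F) : P.adjoint.adjoint = P := adj_adj P

theorem adjoint_add (P Q : MatDiffOp ℓ F) : adjoint (P + Q) = P.adjoint + Q.adjoint := adj_add P Q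

theorem adjoint_sub (P Q : MatDiffOp ℓ F) : adjoint (P - Q) = P.adjoint - Q.adjoint := adj_sub P Q

theorem adjoint_zero : adjoint (0 : MatDiffOp ℓ F) = 0 := by
  ext i j
  exact DiffOp.adjoint_zero

/-- A skewadjoint operator is twice a skewadjoint operator. -/
theorem IsSkewadjoint.exists_half [CharZero F] {S : MatDiffOp ℓ F} (hS : S.IsSkewadjoint) :
    ∃ R : MatDiffOp ℓ F, R + R = S ∧ R.IsSkewadjoint := by
  have h1 : (2⁻¹ : F) • S + (2⁻¹ : F) • S = S := by
    rw [← add_smul, ← two_mul, mul_inv_cancel₀ two_ne_zero, one_smul]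
  refine ⟨(2⁻¹ : F) • S, h1, ?_⟩
  generalize (2⁻¹ : F) • S = R at h1
  -- The adjoint is not F-linear, so skewadjointness of the half is deduced from additivity alone
  -- and division by 2.
  have h2 : (2 : F) • (R.adjoint + R) = 0 := by
    have h3 : adjoint S = -S := hS
    rw [← h1, adjoint_add] at h3
    rw [two_smul, add_add_add_comm, h3, neg_add_cancel]
  exact eq_neg_of_add_eq_zero_left ((smul_eq_zero.mp h2).resolve_left two_ne_zero)

/-- It suffices to solve `K P + Q K^* = R` for skewadjoint `R`. -/
theorem exists_sub_adjoint_eq [CharZero F] (K : MatDiffOp ℓ F)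
    (h : ∀ R : MatDiffOp ℓ F, ∃ P Q : MatDiffOp ℓ F, K * P + Q * K.adjoint = R)
    {S : MatDiffOp ℓ F} (hS : S.IsSkewadjoint) :
    ∃ P : MatDiffOp ℓ F, K * P - P.adjoint * K.adjoint = S := by
  obtain ⟨R, hR, hR'⟩ := hS.exists_half
  obtain ⟨P, Q, hPQ⟩ := h R
  -- With this choice the left side is (K P + Q K^*) minus its adjoint, that is R - R^* = 2R = S.
  refine ⟨P - Q.adjoint, ?_⟩
  have h1 := congrArg adjoint hPQ
  rw [adjoint_add, adjoint_mul, adjoint_mul, adjoint_adjoint, show R.adjoint = -R from hR'] at h1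
  rw [adjoint_sub, adjoint_adjoint, mul_sub, sub_mul, ← hR]
  nth_rewrite 1 [← hPQ]
  rw [← neg_neg R, ← h1]
  abel

/-- Division by K^* leaves a remainder sY, and `X` is chosen with derivative e_M K_{M+1}⁻¹ s, so
that the main term of the fundamental identity is exactly sY. -/
theorem exists_mul_add_mul_adjoint_eq (hF : LinearlyClosed F) {K : MatDiffOp ℓ F}
    (hK : K.OrderLT (M + 2)) (hu : IsUnit (K.coeff (M + 1))) (R : MatDiffOp ℓ F) :
    ∃ P Q : MatDiffOp ℓ F, K * P + Q * K.adjoint = R := by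
  obtain ⟨Q, hQ⟩ := exists_sub_mul_orderLT (coeff_adjoint hK).2 (isUnit_coeff_adjoint hK hu) R
  obtain ⟨s, hs⟩ := exists_eq_ofMat_mul_hornerCol hK hu hQ
  obtain ⟨X, hX⟩ := hF.connection_surjective (isConnection_bracketConn (companion M K))
    (blockIncl F ℓ (Fin.last M) * ((K.coeff (M + 1))⁻¹ * s))
  refine ⟨ofBlocks K X, Q + (ofBlocks K X.transpose).adjoint, ?_⟩
  rw [mul_ofBlocks hK hu, hX, ofMat_mul, ← Matrix.mul_assoc, ← Matrix.mul_assoc,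
    hornerRow_mul_blockIncl_last hK, ← ofMat_mul,
    Matrix.mul_nonsing_inv_cancel_left _ _ ((Matrix.isUnit_iff_isUnit_det _).mp hu), ← hs, add_mul]
  abel

theorem bracketConn_companion_castSucc (K : MatDiffOp ℓ F)
    (X : Matrix (Fin (M + 1) × Fin ℓ) (Fin (M + 1) × Fin ℓ) F) (k : Fin M) (a : Fin ℓ)
    (q : Fin (M + 1) × Fin ℓ) :
    bracketConn (companion M K) X (k.castSucc, a) q =
      derivMat X (k.castSucc, a) q - X (k.succ, a) q -
        (X * (companion M K).transpose) (k.castSucc, a) q := by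
  rw [bracketConn_apply, Matrix.sub_apply, Matrix.sub_apply, companion_mul_castSucc]

/-- A horizontal matrix is determined by its first block row. -/
theorem eq_zero_of_bracketConn_eq_zero (K : MatDiffOp ℓ F)
    {X : Matrix (Fin (M + 1) × Fin ℓ) (Fin (M + 1) × Fin ℓ) F}
    (hX : bracketConn (companion M K) X = 0)
    (h0 : (blockIncl F ℓ (0 : Fin (M + 1))).transpose * X = 0) : X = 0 := by
  suffices h : ∀ (k : Fin (M + 1)) (a : Fin ℓ), X (k, a) = 0 by
    ext p q
    exact congrFun (h p.1 p.2) q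
  intro k
  induction k using Fin.induction with
  | zero =>
    intro a
    funext q
    rw [← transpose_blockIncl_mul (0 : Fin (M + 1)) X a q, h0]
    rfl
  | succ k ih =>
    intro a
    funext q
    have h := congrFun (congrFun hX (k.castSucc, a)) q
    rw [bracketConn_companion_castSucc, derivMat_apply, Matrix.mul_apply, ih a] at h
    simpa using h

/-- A first block row extends to a matrix whose covariant derivative lives in the last block row. -/
theorem exists_bracketConn_eq (K : MatDiffOp ℓ F) (x : Matrix (Fin ℓ) (Fin (M + 1) × Fin ℓ) F) :
    ∃ (X : Matrix (Fin (M + 1) × Fin ℓ) (Fin (M + 1) × Fin ℓ) F)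
      (C : Matrix (Fin ℓ) (Fin (M + 1) × Fin ℓ) F),
      (blockIncl F ℓ (0 : Fin (M + 1))).transpose * X = x ∧
      bracketConn (companion M K) X = blockIncl F ℓ (Fin.last M) * C := by
  -- Vanishing of block row k < M of the derivative reads Xₖ₊₁ = Xₖ′ - Xₖ Aᵀ, so the block rows are
  -- the iterates of `T` on `x`.
  let T : Matrix (Fin ℓ) (Fin (M + 1) × Fin ℓ) F → Matrix (Fin ℓ) (Fin (M + 1) × Fin ℓ) F :=
    fun y => derivMat y - y * (companion M K).transpose
  let X : Matrix (Fin (M + 1) × Fin ℓ) (Fin (M + 1) × Fin ℓ) F :=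
    Matrix.of fun p q => T^[p.1] x p.2 q
  refine ⟨X, Matrix.of fun a q => bracketConn (companion M K) X (Fin.last M, a) q, ?_, ?_⟩
  · ext a q
    rw [transpose_blockIncl_mul]
    rfl
  · ext ⟨k, a⟩ q
    rw [blockIncl_mul]
    induction k using Fin.lastCases with
    | last => rw [if_pos rfl]; rfl
    | cast k =>
      rw [if_neg (Fin.castSucc_lt_last k).ne, bracketConn_companion_castSucc]
      have h : X (k.succ, a) q = T (T^[k] x) a q := by
        rw [← Function.iterate_succ_apply' T]
        rfl
      rw [h, sub_right_comm, sub_eq_zero]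
      rfl

theorem ofBlocks_add (K : MatDiffOp ℓ F)
    (X Y : Matrix (Fin (M + 1) × Fin ℓ) (Fin (M + 1) × Fin ℓ) F) :
    ofBlocks K (X + Y) = ofBlocks K X + ofBlocks K Y := by
  rw [ofBlocks, Matrix.mul_add, ofMat_add, Matrix.add_mul]
  rfl

theorem ofBlocks_smul (K : MatDiffOp ℓ F) (c : F)
    (X : Matrix (Fin (M + 1) × Fin ℓ) (Fin (M + 1) × Fin ℓ) F) :
    ofBlocks K (c • X) = c • ofBlocks K X := by
  rw [ofBlocks, ofBlocks, Matrix.mul_smul]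
  refine ext_coeffMat fun k => ?_
  have h : ∀ V : MatDiffOp ℓ F, coeffMat (c • V) k = c • coeffMat V k := fun V => by
    ext i j
    exact DiffOp.coeff_smul _ _ _
  rw [h, coeffMat_ofMat_mul, coeffMat_ofMat_mul, Matrix.smul_mul]

/-- `ofBlocks` on the horizontal antisymmetric matrices. -/
def ofHorizontal (M : ℕ) (K : MatDiffOp ℓ F) :
    horizontal (isConnection_skewConn (companion M K)) →ₗ[constantSubfield F] MatDiffOp ℓ F where
  toFun X := ofBlocks K X.1.1
  map_add' X Y := ofBlocks_add K X.1.1 Y.1.1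
  map_smul' c X := ofBlocks_smul K c X.1.1

theorem ofHorizontal_injective {K : MatDiffOp ℓ F} (hK : K.OrderLT (M + 2))
    (hu : IsUnit (K.coeff (M + 1))) : Function.Injective (ofHorizontal M K) := by
  refine (injective_iff_map_eq_zero _).mpr fun X hX => ?_
  refine Subtype.ext (Subtype.ext ?_)
  exact eq_zero_of_bracketConn_eq_zero K (congrArg Subtype.val X.2)
    (ofMat_mul_hornerCol_injective hK hu hX)

theorem mem_range_ofHorizontal {K : MatDiffOp ℓ F} (hK : K.OrderLT (M + 2))
    (hu : IsUnit (K.coeff (M + 1))) (P : MatDiffOp ℓ F) :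
    P ∈ LinearMap.range (ofHorizontal M K) ↔ P.OrderLT (M + 1) ∧ IsSelfadjoint (K * P) := by
  constructor
  · rintro ⟨X, rfl⟩
    refine ⟨ofMat_mul_hornerCol_orderLT hK _, ?_⟩
    have hX : bracketConn (companion M K) X.1.1 = 0 := congrArg Subtype.val X.2
    have h := mul_ofBlocks_of_skew hK hu X.1.2
    rw [hX, ofMat_zero, Matrix.zero_mul, Matrix.mul_zero, zero_add] at h
    change adjoint (K * ofBlocks K X.1.1) = K * ofBlocks K X.1.1
    rw [adjoint_mul, h]
  · rintro ⟨hP, hS⟩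
    have hS' : adjoint (K * P) = K * P := hS
    obtain ⟨x, hx⟩ := exists_eq_ofMat_mul_hornerCol hK hu hP
    obtain ⟨X, C, hX0, hXC⟩ := exists_bracketConn_eq K x
    have hPX : ofBlocks K X = P := by rw [ofBlocks, hX0, hx]
    have h := mul_ofBlocks hK hu X
    rw [hXC, ofMat_mul, ← Matrix.mul_assoc, ← Matrix.mul_assoc, hornerRow_mul_blockIncl_last hK,
      hPX, ← hS', adjoint_mul, ← ofMat_mul, eq_sub_iff_add_eq, ← add_mul] at h
    have hL := (coeff_adjoint hK).2
    have hLu := isUnit_coeff_adjoint hK hu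
    -- At this point (P^* + (P_{Xᵀ})^*) K^* = K_{M+1} C Y. The right side has order at most `M`,
    -- below that of K^*, so the left factor vanishes, and then so does `C`.
    have hQ := eq_zero_of_mul_orderLT hL hLu (h ▸ ofMat_mul_hornerCol_orderLT hK _)
    rw [hQ, zero_mul] at h
    have hC : C = 0 := by
      have := ofMat_mul_hornerCol_injective hK hu h.symm
      rw [← Matrix.nonsing_inv_mul_cancel_left _ C ((Matrix.isUnit_iff_isUnit_det _).mp hu), this,
        Matrix.mul_zero]
    have hXh : bracketConn (companion M K) X = 0 := by rw [hXC, hC, Matrix.mul_zero]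
    -- The vanishing left factor is the adjoint of this operator. So X + Xᵀ is horizontal with zero
    -- first block row, hence zero.
    have hsum : ofBlocks K (X + X.transpose) = 0 := by
      rw [ofBlocks_add, hPX, ← adjoint_adjoint (P + _), adjoint_add, hQ, adjoint_zero]
    have hskew : X + X.transpose = 0 := by
      refine eq_zero_of_bracketConn_eq_zero K ?_ (ofMat_mul_hornerCol_injective hK hu hsum)
      rw [map_add, ← transpose_bracketConn, hXh, Matrix.transpose_zero, add_zero]
    have hmem : X ∈ skewMatrices F (Fin (M + 1) × Fin ℓ) := eq_neg_of_add_eq_zero_right hskew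
    exact ⟨⟨⟨X, hmem⟩, Subtype.ext hXh⟩, hPX⟩

theorem coeff_zero_of_orderLT_one {K : MatDiffOp ℓ F} (hK : K.OrderLT 1) :
    K = ofMat (K.coeff 0) := by
  refine ext_coeffMat fun k => ?_
  ext i j
  rw [coeffMat_apply, coeffMat_apply, ofMat_apply, DiffOp.mulOp, DiffOp.coeff_monomial]
  split_ifs with h
  · subst h; rfl
  · exact hK.coeff_eq_zero i j k (by lia)

theorem exists_mul_eq_of_orderLT_one {K : MatDiffOp ℓ F} (hK : K.OrderLT 1)
    (hu : IsUnit (K.coeff 0)) (R : MatDiffOp ℓ F) : ∃ P : MatDiffOp ℓ F, K * P = R := by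
  refine ⟨ofMat (K.coeff 0)⁻¹ * R, ?_⟩
  nth_rewrite 1 [coeff_zero_of_orderLT_one hK]
  rw [← Matrix.mul_assoc, ← ofMat_mul,
    Matrix.mul_nonsing_inv _ ((Matrix.isUnit_iff_isUnit_det _).mp hu)]
  have h : ofMat (1 : Matrix (Fin ℓ) (Fin ℓ) F) = 1 :=
    Matrix.map_one _ (map_zero DiffOp.mulOpHom) (map_one DiffOp.mulOpHom)
  rw [h, Matrix.one_mul]

end MatDiffOp

end

theorem mainTheorem6 {F : Type*} [Field F] [CharZero F] [Differential F] (ℓ N : ℕ)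
    (K : MatDiffOp ℓ F) (hK : K.OrderLT (N + 1)) (hlead : IsUnit (K.coeff N)) :
    (LinearlyClosed F → ∀ S : MatDiffOp ℓ F, S.IsSkewadjoint →
      ∃ P : MatDiffOp ℓ F, K * P - P.adjoint * K.adjoint = S) ∧
    (∃ W : Submodule (constantSubfield F) (MatDiffOp ℓ F),
      (∀ P : MatDiffOp ℓ F, P ∈ W ↔ P.OrderLT N ∧ MatDiffOp.IsSelfadjoint (K * P)) ∧
      Module.rank (constantSubfield F) W ≤ ((N * ℓ).choose 2 : Cardinal) ∧
      (LinearlyClosed F →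
        Module.rank (constantSubfield F) W = ((N * ℓ).choose 2 : Cardinal))) := by
  obtain _ | M := N
  -- In order zero, `K` is an invertible matrix over `F`: the equation is solved by its inverse, and
  -- the space in (b) is zero.
  · refine ⟨fun _ S hS => MatDiffOp.exists_sub_adjoint_eq K (fun R => ?_) hS, ⊥, fun P => ?_, ?_, ?_⟩
    · obtain ⟨P, hP⟩ := MatDiffOp.exists_mul_eq_of_orderLT_one hK hlead R
      exact ⟨P, 0, by rw [hP, Matrix.zero_mul, add_zero]⟩
    · rw [Submodule.mem_bot]
      constructor
      · rintro rfl
        refine ⟨fun k _ => MatDiffOp.coeffMat_zero k, ?_⟩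
        rw [Matrix.mul_zero]
        exact MatDiffOp.adjoint_zero
      · exact fun h => MatDiffOp.eq_zero_of_orderLT_zero h.1
    · simp
    · simp
  · have e := LinearEquiv.ofInjective _ (MatDiffOp.ofHorizontal_injective hK hlead)
    have hrank := rank_skewMatrices (F := F) (ι := Fin (M + 1) × Fin ℓ)
    rw [Fintype.card_prod, Fintype.card_fin, Fintype.card_fin] at hrank
    refine ⟨fun hF S hS => MatDiffOp.exists_sub_adjoint_eq K
      (MatDiffOp.exists_mul_add_mul_adjoint_eq hF hK hlead) hS,
      LinearMap.range (MatDiffOp.ofHorizontal M K), MatDiffOp.mem_range_ofHorizontal hK hlead, ?_,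
      fun hF => ?_⟩
    · rw [← e.rank_eq, ← hrank]
      exact rank_horizontal_le _
    · rw [← e.rank_eq, ← hrank]
      exact hF.rank_horizontal _
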